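/- Let $(U_\nu)$ be a sequence of finite populations $U=\{1,\dots,N\}$ with $N=N_\nu\to\infty$ (all quantities below may depend on $\nu$; $p$ is fixed). Unit $i$ carries non-random $y_i\in\mathbb R$ and $\mathbf x_i\in\mathbb R^p$. A random sample $A\subseteq U$ of (random) size $n=|A|$ is drawn by a sampling design with indicators $\delta_i=1\{i\in A\}$, first- and second-order inclusion probabilities $\pi_i=P(i\in A)$, $\pi_{ij}=P(i,j\in A)$; put $d_i=\pi_i^{-1}$, $\mathbf z_i=(\mathbf x_i^\top,\log(1-\pi_i))^\top\in\mathbb R^{p+1}$ and $\theta_N=\sum_{i\in U}y_i$. Assume: (i) there are constants $c_1,c_2\in(1,\infty)$ with $c_1<d_i<c_2$ for all $i\in U$ and all $\nu$; (ii) $\limsup N\max_{i\ne j}|\pi_{ij}-\pi_i\pi_j|<\infty$; (iii) $\lim N^{-1}\sum_{i\in U}\mathbf z_i\mathbf z_i^\top$ exists and is positive definite; $\limsup N^{-1}\sum_{i\in U}\|(y_i,\mathbf x_i^\top)\|^4<\infty$; and $\lim N^{-1}\sum_{i\in U}f'(\boldsymbol\lambda^\top\mathbf z_i)\mathbf z_i\mathbf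 z_i^\top$ exists for all $\boldsymbol\lambda$ in a neighborhood of $\boldsymbol\lambda_0=(\mathbf 0^\top,1)^\top$, where $f(u)=1/(1-e^{u})$ is the inverse of $g(\omega)=G'(\omega)=\log(1-\omega^{-1})$, $\omega>1$ (here $f'(u)$ is given by the same formula $e^u/(1-e^u)^2$ for $u>0$, and is read as $0$ at $u=0$). Let $G(\omega)=(\omega-1)\log(\omega-1)-\omega\log\omega$ for $\omega>1$, and let the cross-entropy calibration weights $\hat{\boldsymbol\omega}=(\hat\omega_i)_{i\in A}$ minimize $\sum_{i\in A}G(\omega_i)$ over all $(\omega_i)_{i\in A}\in(1,\infty)^A$ with $\sum_{i\in A}\omega_i\mathbf x_i=\sum_{i\in U}\mathbf x_i$ and $\sum_{i\in A}\omega_i\log(1-\pi_i)=\sum_{i\in U}\log(1-\pi_i)$. Then $\hat{\boldsymbol\omega}$ exists and is unique with probability tending to $1$. Suppose moreover that for each $\nu$ the $\delta_i$, $i\in U$, are independent (Poisson sampling). For $\boldsymbol\xi\in\mathbb R^{p+1}$ let $\hat\theta_{\boldsymbol\xi}=\sum_{i\in U}\mathbf z_i^\top\boldsymbol\xi+\sum_{i\in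 A}d_i(y_i-\mathbf z_i^\top\boldsymbol\xi)$, let $\mathcal B=\{\hat\theta_{\boldsymbol\xi}:\boldsymbol\xi\in\mathbb R^{p+1}\}$, and let $\hat\theta_{\rm greg,opt}=\hat\theta_{\boldsymbol\gamma_{\rm opt}}$ with $\boldsymbol\gamma_{\rm opt}=\{\mathbb V(\sum_{i\in A}d_i\mathbf z_i)\}^{-1}\mathbb C(\sum_{i\in A}d_i\mathbf z_i,\sum_{i\in A}d_iy_i)$ (design variance and covariance). For all large $\nu$ the matrix $\mathbb V(\sum_{i\in A}d_i\mathbf z_i)$ is positive definite and $\hat\theta_{\rm greg,opt}$ has the smallest design variance in $\mathcal B$. The estimator $\hat\theta_{\rm cal}=\sum_{i\in A}\hat\omega_iy_i$ (with arbitrary weights, depending on the sample only, where no solution exists) satisfies $$\hat\theta_{\rm cal}=\hat\theta_{\rm greg,opt}+o_p(n^{-1/2}N),$$ and it is asymptotically optimal in $\mathcal B$: for every $M>0$, $$\limsup_{\nu\to\infty}\Big(E\big[\min\{N^{-1}(\hat\theta_{\rm cal}-\theta_N)^2,\,M\}\big]-\inf_{\boldsymbol\xi\in\mathbb R^{p+1}}N^{-1}\mathbb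 V(\hat\theta_{\boldsymbol\xi})\Big)\le 0 .$$ -/

import Mathlib

open MeasureTheory ProbabilityTheory Filter Topology

noncomputable section

/-- The cross entropy `G(w) = (w - 1) log (w - 1) - w log w`, used on its domain `w > 1`. -/
def crossEntropy (w : ℝ) : ℝ := (w - 1) * Real.log (w - 1) - w * Real.log w

/-- `f(u) = 1 / (1 - exp u)`, the inverse on `u < 0` of `g(w) = G'(w) = log (1 - 1 / w)`, `w > 1`. -/
def crossEntropyInv (u : ℝ) : ℝ := (1 - Real.exp u)⁻¹

/-- The augmented covariate `z_i = (x_i, g(d_i))`, where `d_i = 1 / π_i`, so that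
`g(d_i) = log (1 - π_i)`. -/
def augCovariate {p N : ℕ} (x : Fin N → Fin p → ℝ) (π : Fin N → ℝ) (i : Fin N) :
    Fin p ⊕ Unit → ℝ :=
  Sum.elim (x i) (fun _ => Real.log (1 - π i))

/-- The calibration weights `(w_i)_{i ∈ A}` in the domain of the cross entropy: `w_i > 1`, and
`∑_{i ∈ A} w_i z_i = ∑_{i ∈ U} z_i` (benchmarking and debiasing constraints together). -/
def feasibleWeights {N : ℕ} {ι : Type*} (z : Fin N → ι → ℝ) (A : Finset (Fin N)) :
    Set (A → ℝ) :=
  {w | (∀ i, 1 < w i) ∧ ∑ i : A, w i • z i = ∑ i : Fin N, z i}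

/-- `w` minimizes `∑_{i ∈ A} G(w_i)` over the feasible weights. -/
def IsCrossEntropyWeight {N : ℕ} {ι : Type*} (z : Fin N → ι → ℝ) (A : Finset (Fin N))
    (w : A → ℝ) : Prop :=
  w ∈ feasibleWeights z A ∧
    IsMinOn (fun v : A → ℝ => ∑ i : A, crossEntropy (v i)) (feasibleWeights z A) w

/-- The Horvitz-Thompson estimator `∑_{i ∈ A} d_i v_i`. -/
def htEstimator {N : ℕ} (π : Fin N → ℝ) (v : Fin N → ℝ) (A : Finset (Fin N)) : ℝ :=
  ∑ i ∈ A, (π i)⁻¹ * v i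

/-- The regression estimator `∑_{i ∈ U} z_i' ξ + ∑_{i ∈ A} d_i (y_i - z_i' ξ)`. -/
def gregEstimator {N : ℕ} {ι : Type*} [Fintype ι] (π : Fin N → ℝ) (z : Fin N → ι → ℝ)
    (y : Fin N → ℝ) (ξ : ι → ℝ) (A : Finset (Fin N)) : ℝ :=
  ∑ i, z i ⬝ᵥ ξ + ∑ i ∈ A, (π i)⁻¹ * (y i - z i ⬝ᵥ ξ)

/-- The design covariance matrix of `∑_{i ∈ A} d_i z_i`. -/
def htVarMatrix {Ω : Type*} [MeasurableSpace Ω] (P : Measure Ω) {N : ℕ} {ι : Type*}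
    (A : Ω → Finset (Fin N)) (π : Fin N → ℝ) (z : Fin N → ι → ℝ) : Matrix ι ι ℝ :=
  Matrix.of fun j k =>
    cov[fun ω => htEstimator π (fun i => z i j) (A ω),
      fun ω => htEstimator π (fun i => z i k) (A ω); P]

/-- The vector of design covariances of `∑_{i ∈ A} d_i z_i` with `∑_{i ∈ A} d_i y_i`. -/
def htCovVec {Ω : Type*} [MeasurableSpace Ω] (P : Measure Ω) {N : ℕ} {ι : Type*}
    (A : Ω → Finset (Fin N)) (π : Fin N → ℝ) (z : Fin N → ι → ℝ) (y : Fin N → ℝ) : ι → ℝ :=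
  fun j =>
    cov[fun ω => htEstimator π (fun i => z i j) (A ω), fun ω => htEstimator π y (A ω); P]

/-- The coefficient `γ_opt` of the design-optimal regression estimator. -/
def gammaOpt {Ω : Type*} [MeasurableSpace Ω] (P : Measure Ω) {N : ℕ} {ι : Type*}
    [Fintype ι] [DecidableEq ι]
    (A : Ω → Finset (Fin N)) (π : Fin N → ℝ) (z : Fin N → ι → ℝ) (y : Fin N → ℝ) : ι → ℝ :=
  (htVarMatrix P A π z)⁻¹.mulVec (htCovVec P A π z y)

/-- The weighted estimator `∑_{i ∈ A} w_i y_i`. -/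
def weightedTotal {N : ℕ} (y : Fin N → ℝ) (A : Finset (Fin N)) (w : A → ℝ) : ℝ :=
  ∑ i : A, w i * y i

end

/-! Write `f` for `crossEntropyInv` and `d_i` for `1/π_i`. By Lagrange duality the calibration
weights are `f(z_i'λ)`, where `λ` solves the dual equation `∑_A f(z_i'λ) z_i = ∑_U z_i`
(`crossEntropyWeight_of_dual`). Since `log (1 - π_i)` is a coordinate of `z_i`, the choice `λ₀ = (0,
1)` returns the design weights `d_i`. The dual equation fails at `λ₀` only by a Horvitz-Thompson
error `O_p(√N)`, while the Hessian of the dual objective is of order `N`. Hence there is a solution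
`λ₀ + h` with `h = O_p(1/√N)` (`exists_dual_solution`, `exists_dual_solution_of_concentration`).

For any `γ`, calibration gives exactly `θ_cal - θ_γ = ∑_A (f(z_i'λ) - d_i) e_i` with `e_i = y_i -
z_i'γ`. Expand at `λ₀`. Because `f' = f (f - 1)`, the linear coefficient is `∑_A d_i (d_i - 1) z_i
e_i`, with mean `∑_U (d_i - 1) z_i e_i`. Under Poisson sampling this mean is the design covariance
of the Horvitz-Thompson totals of `z` and `e`, so it vanishes at `γ_opt`: this is why the cross
entropy yields the optimal regression estimator. The linear coefficient is then `O_p(√N)`, and both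
the linear term and the quadratic remainder are `O_p(1)` (`calibration_bounded_in_probability`).

So `θ_cal - θ_opt = O_p(1)`, more than the claimed order since `n ≤ N`. Truncation makes closeness
in probability enough to compare risks, through `integral_min_sq_le`. -/

/-! ### Scalar calculus of the cross entropy, its inverse derivative and its conjugate -/

/-- Quadratic lower bound from a lower bound on the second derivative. -/
theorem quadratic_lower_bound {s : Set ℝ} (hs : Convex ℝ s) {F f f' : ℝ → ℝ} {m : ℝ}
    (hF : ∀ x ∈ s, HasDerivAt F (f x) x) (hf : ∀ x ∈ s, HasDerivAt f (f' x) x)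
    (hm : ∀ x ∈ s, m ≤ f' x) {u v : ℝ} (hu : u ∈ s) (hv : v ∈ s) :
    F u + f u * (v - u) + m / 2 * (v - u) ^ 2 ≤ F v := by
  -- The derivative of the gap `F x - F u - f u (x - u) - m/2 (x - u)²` is the increment of this
  -- monotone function, so the gap decreases to the left of `u` and increases to the right.
  have hmono : MonotoneOn (fun x => f x - m * x) s := by
    refine monotoneOn_of_hasDerivWithinAt_nonneg (f' := fun x => f' x - m) hs ?_ ?_ ?_
    · intro x hx
      exact ((hf x hx).continuousAt.sub (by fun_prop)).continuousWithinAt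
    · intro x hx
      have := (hf x (interior_subset hx)).sub ((hasDerivAt_id x).const_mul m)
      exact (this.congr_deriv (by ring)).hasDerivWithinAt
    · intro x hx
      linarith [hm x (interior_subset hx)]
  have hψ : ∀ x ∈ s, HasDerivAt (fun x => F x - F u - f u * (x - u) - m / 2 * (x - u) ^ 2)
      (f x - f u - m * (x - u)) x := by
    intro x hx
    have h1 := ((hF x hx).sub_const (F u)).sub (((hasDerivAt_id x).sub_const u).const_mul (f u))
    have h2 := (((hasDerivAt_id x).sub_const u).pow 2).const_mul (m / 2)
    refine (h1.sub h2).congr_deriv ?_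
    simp only [id]
    push_cast
    ring
  have key : 0 ≤ F v - F u - f u * (v - u) - m / 2 * (v - u) ^ 2 := by
    rcases le_total u v with huv | huv
    · have hsub : Set.Icc u v ⊆ s := hs.ordConnected.out hu hv
      have hmo := monotoneOn_of_hasDerivWithinAt_nonneg (convex_Icc u v)
        (fun x hx => (hψ x (hsub hx)).continuousAt.continuousWithinAt)
        (fun x hx => (hψ x (hsub (interior_subset hx))).hasDerivWithinAt)
        (fun x hx => by
          have hx' := interior_subset hx
          have := hmono hu (hsub hx') hx'.1
          simp only at this
          linarith)
      have := hmo (Set.left_mem_Icc.2 huv) (Set.right_mem_Icc.2 huv) huv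
      simpa using this
    · have hsub : Set.Icc v u ⊆ s := hs.ordConnected.out hv hu
      have hmo := antitoneOn_of_hasDerivWithinAt_nonpos (convex_Icc v u)
        (fun x hx => (hψ x (hsub hx)).continuousAt.continuousWithinAt)
        (fun x hx => (hψ x (hsub (interior_subset hx))).hasDerivWithinAt)
        (fun x hx => by
          have hx' := interior_subset hx
          have := hmono (hsub hx') hu hx'.2
          simp only at this
          linarith)
      have := hmo (Set.left_mem_Icc.2 huv) (Set.right_mem_Icc.2 huv) huv
      simpa using this
  linarith

theorem one_sub_exp_pos {u : ℝ} (hu : u < 0) : 0 < 1 - Real.exp u := by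
  have := Real.exp_lt_exp.2 hu
  rw [Real.exp_zero] at this
  linarith

theorem one_lt_crossEntropyInv {u : ℝ} (hu : u < 0) : 1 < crossEntropyInv u := by
  have h := one_sub_exp_pos hu
  exact (one_lt_inv₀ h).2 (by linarith [Real.exp_pos u])

theorem crossEntropyInv_le {a u : ℝ} (ha : 0 < a) (hu : u ≤ -a) :
    crossEntropyInv u ≤ crossEntropyInv (-a) := by
  have h1 := one_sub_exp_pos (neg_lt_zero.2 ha)
  have h2 := Real.exp_le_exp.2 hu
  exact inv_anti₀ h1 (by linarith)

/-- The logistic-type identity `f' = f (f - 1)` makes every higher derivative a polynomial in `f`,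
and turns `f'` at `log (1 - π)` into `d (d - 1)`. -/
theorem hasDerivAt_crossEntropyInv {u : ℝ} (hu : u < 0) :
    HasDerivAt crossEntropyInv (crossEntropyInv u * (crossEntropyInv u - 1)) u := by
  have h := one_sub_exp_pos hu
  have h1 := ((Real.hasDerivAt_exp u).const_sub 1).inv h.ne'
  refine h1.congr_deriv ?_
  unfold crossEntropyInv
  field_simp
  ring

theorem hasDerivAt_crossEntropyInv_deriv {u : ℝ} (hu : u < 0) :
    HasDerivAt (fun u => crossEntropyInv u * (crossEntropyInv u - 1))
      ((2 * crossEntropyInv u - 1) * (crossEntropyInv u * (crossEntropyInv u - 1))) u := by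
  have h := hasDerivAt_crossEntropyInv hu
  refine (h.mul (h.sub_const 1)).congr_deriv ?_
  ring

/-- The convex conjugate of the cross entropy. -/
noncomputable def crossEntropyConj (u : ℝ) : ℝ := u - Real.log (1 - Real.exp u)

theorem hasDerivAt_crossEntropyConj {u : ℝ} (hu : u < 0) :
    HasDerivAt crossEntropyConj (crossEntropyInv u) u := by
  have h := one_sub_exp_pos hu
  refine ((hasDerivAt_id u).sub (((Real.hasDerivAt_exp u).const_sub 1).log h.ne')).congr_deriv ?_
  unfold crossEntropyInv
  field_simp
  ring

theorem exp_le_crossEntropyInv_deriv {u : ℝ} (hu : u < 0) :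
    Real.exp u ≤ crossEntropyInv u * (crossEntropyInv u - 1) := by
  have h := one_sub_exp_pos hu
  have h1 := one_lt_crossEntropyInv hu
  have h2 : crossEntropyInv u * (1 - Real.exp u) = 1 := inv_mul_cancel₀ h.ne'
  have h3 : crossEntropyInv u - 1 = crossEntropyInv u * Real.exp u := by linarith
  rw [h3]
  have := Real.exp_pos u
  have h4 : 1 ≤ crossEntropyInv u * crossEntropyInv u := by nlinarith
  nlinarith

theorem crossEntropyConj_lower_bound {B u v : ℝ} (hu : u ∈ Set.Ico (-B) 0)
    (hv : v ∈ Set.Ico (-B) 0) :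
    crossEntropyConj u + crossEntropyInv u * (v - u) + Real.exp (-B) / 2 * (v - u) ^ 2 ≤
      crossEntropyConj v :=
  quadratic_lower_bound (convex_Ico (-B) 0) (fun _ hx => hasDerivAt_crossEntropyConj hx.2)
    (fun _ hx => hasDerivAt_crossEntropyInv hx.2)
    (fun _ hx => (Real.exp_le_exp.2 hx.1).trans (exp_le_crossEntropyInv_deriv hx.2)) hu hv

/-- As `f` is increasing and exceeds 1, `|f''| = (2f - 1) f (f - 1) ≤ 2 f(-a)³` to the left of `-a`.
The quadratic bound applied to `f` and to `-f` gives the two sides. -/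
theorem crossEntropyInv_taylor {a : ℝ} (ha : 0 < a) {u v : ℝ} (hu : u ≤ -a) (hv : v ≤ -a) :
    |crossEntropyInv v - crossEntropyInv u -
        crossEntropyInv u * (crossEntropyInv u - 1) * (v - u)| ≤
      crossEntropyInv (-a) ^ 3 * (v - u) ^ 2 := by
  have hneg : ∀ x ∈ Set.Iic (-a), x < 0 := fun x hx => lt_of_le_of_lt hx (neg_lt_zero.2 ha)
  have hb : ∀ x ∈ Set.Iic (-a),
      |(2 * crossEntropyInv x - 1) * (crossEntropyInv x * (crossEntropyInv x - 1))| ≤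
        2 * crossEntropyInv (-a) ^ 3 := by
    intro x hx
    have h1 := one_lt_crossEntropyInv (hneg x hx)
    have h2 := crossEntropyInv_le ha hx
    have h3 : 0 ≤ (2 * crossEntropyInv x - 1) * (crossEntropyInv x * (crossEntropyInv x - 1)) :=
      mul_nonneg (by linarith) (mul_nonneg (by linarith) (by linarith))
    rw [abs_of_nonneg h3]
    calc _ ≤ (2 * crossEntropyInv x) * (crossEntropyInv x * crossEntropyInv x) := by
          refine mul_le_mul (by linarith) ?_ ?_ (by linarith)
          · exact mul_le_mul_of_nonneg_left (by linarith) (by linarith)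
          · exact mul_nonneg (by linarith) (by linarith)
      _ = 2 * crossEntropyInv x ^ 3 := by ring
      _ ≤ _ := by
          have h0 : 0 ≤ crossEntropyInv x := by linarith
          gcongr
  have h1 := quadratic_lower_bound (convex_Iic (-a))
    (fun x hx => hasDerivAt_crossEntropyInv (hneg x hx))
    (fun x hx => hasDerivAt_crossEntropyInv_deriv (hneg x hx))
    (fun x hx => (abs_le.1 (hb x hx)).1) (u := u) (v := v) hu hv
  have h2 := quadratic_lower_bound (convex_Iic (-a))
    (fun x hx => (hasDerivAt_crossEntropyInv (hneg x hx)).neg)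
    (fun x hx => (hasDerivAt_crossEntropyInv_deriv (hneg x hx)).neg)
    (fun x hx => neg_le_neg (abs_le.1 (hb x hx)).2) (u := u) (v := v) hu hv
  simp only [Pi.neg_apply] at h2
  rw [abs_le]
  constructor <;> linarith

theorem hasDerivAt_crossEntropy {w : ℝ} (hw : 1 < w) :
    HasDerivAt crossEntropy (Real.log (w - 1) - Real.log w) w := by
  have h1 := (Real.hasDerivAt_mul_log (sub_pos.2 hw).ne').comp w ((hasDerivAt_id w).sub_const 1)
  have h2 := Real.hasDerivAt_mul_log (show w ≠ 0 by positivity)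
  refine (h1.sub h2).congr_deriv ?_
  simp

/-- `G''(x) = 1 / (x (x - 1))` is at least `1 / max(w, v)²` on `(1, max(w, v)]`, an interval
containing both points. -/
theorem crossEntropy_strict_tangent {w v : ℝ} (hw : 1 < w) (hv : 1 < v) (hne : v ≠ w) :
    crossEntropy w + (Real.log (w - 1) - Real.log w) * (v - w) < crossEntropy v := by
  set s := Set.Ioc 1 (max w v)
  have hd : ∀ x ∈ s, HasDerivAt (fun w => Real.log (w - 1) - Real.log w)
      ((x - 1)⁻¹ - x⁻¹) x := by
    intro x hx
    have h0 : (1 : ℝ) < x := hx.1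
    refine ((((hasDerivAt_id x).sub_const 1).log (sub_pos.2 h0).ne').sub
      (Real.hasDerivAt_log (by positivity))).congr_deriv ?_
    simp
  have hM : 1 < max w v := lt_max_of_lt_left hw
  have h := quadratic_lower_bound (convex_Ioc 1 (max w v))
    (fun x hx => hasDerivAt_crossEntropy hx.1) hd (m := (max w v ^ 2)⁻¹) (fun x hx => by
      have h0 : (1 : ℝ) < x := hx.1
      have h1 : (x - 1)⁻¹ - x⁻¹ = ((x - 1) * x)⁻¹ := by
        have : x - 1 ≠ 0 := by linarith
        field_simp
        ring
      rw [h1]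
      refine inv_anti₀ (mul_pos (by linarith) (by linarith)) ?_
      have := hx.2
      nlinarith) (u := w) (v := v) ⟨hw, le_max_left _ _⟩ ⟨hv, le_max_right _ _⟩
  have hp : 0 < (max w v ^ 2)⁻¹ / 2 * (v - w) ^ 2 := by
    have : v - w ≠ 0 := sub_ne_zero.2 hne
    positivity
  linarith

theorem log_crossEntropyInv {u : ℝ} (hu : u < 0) :
    Real.log (crossEntropyInv u - 1) - Real.log (crossEntropyInv u) = u := by
  have h := one_sub_exp_pos hu
  have h3 : crossEntropyInv u - 1 = crossEntropyInv u * Real.exp u := by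
    unfold crossEntropyInv
    field_simp
    ring
  have h1 := one_lt_crossEntropyInv hu
  rw [h3, Real.log_mul (by linarith) (Real.exp_pos u).ne', Real.log_exp]
  ring

theorem crossEntropyInv_log {t : ℝ} (h1 : t < 1) :
    crossEntropyInv (Real.log (1 - t)) = t⁻¹ := by
  unfold crossEntropyInv
  rw [Real.exp_log (by linarith)]
  congr 1
  ring

/-! ### Lagrange duality and solvability of the dual equation -/

/-- Sum the tangent inequalities of `G` at the dual weights, where the slopes are `z_i'λ`. The
linear term is `λ'` applied to a difference of two calibrated totals, hence zero. Strictness of the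
tangent inequality gives uniqueness as well as optimality. -/
theorem crossEntropyWeight_of_dual {N : ℕ} {ι : Type*} [Fintype ι] (z : Fin N → ι → ℝ)
    (s : Finset (Fin N)) (lam : ι → ℝ) (hneg : ∀ i ∈ s, z i ⬝ᵥ lam < 0)
    (hfeas : ∑ i ∈ s, crossEntropyInv (z i ⬝ᵥ lam) • z i = ∑ i, z i) (w : s → ℝ) :
    IsCrossEntropyWeight z s w ↔ w = fun i : s => crossEntropyInv (z i ⬝ᵥ lam) := by
  set w₀ : s → ℝ := fun i => crossEntropyInv (z i ⬝ᵥ lam) with hw₀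
  have hmem : w₀ ∈ feasibleWeights z s :=
    ⟨fun i => one_lt_crossEntropyInv (hneg i i.2),
      (Finset.sum_coe_sort s fun i => crossEntropyInv (z i ⬝ᵥ lam) • z i).trans hfeas⟩
  have hstrict : ∀ v ∈ feasibleWeights z s, v ≠ w₀ →
      ∑ i : s, crossEntropy (w₀ i) < ∑ i : s, crossEntropy (v i) := by
    intro v hv hne
    have hlin : ∑ i : s, (z i ⬝ᵥ lam) * (v i - w₀ i) = 0 := by
      have h : ∑ i : s, (v i - w₀ i) • z i = 0 := by
        simp only [sub_smul, Finset.sum_sub_distrib, hv.2, hmem.2, sub_self]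
      have h2 := congrArg (fun t => t ⬝ᵥ lam) h
      simp only [sum_dotProduct, smul_dotProduct, zero_dotProduct, smul_eq_mul] at h2
      rw [← h2]
      exact Finset.sum_congr rfl fun i _ => mul_comm _ _
    have htan : ∀ i : s, v i ≠ w₀ i →
        crossEntropy (w₀ i) + (z i ⬝ᵥ lam) * (v i - w₀ i) < crossEntropy (v i) := by
      intro i hi
      have h := crossEntropy_strict_tangent (hmem.1 i) (hv.1 i) hi
      rwa [hw₀, log_crossEntropyInv (hneg i i.2)] at h
    obtain ⟨i₀, hi₀⟩ := Function.ne_iff.1 hne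
    have hlt : ∑ i : s, (crossEntropy (w₀ i) + (z i ⬝ᵥ lam) * (v i - w₀ i)) <
        ∑ i : s, crossEntropy (v i) := by
      refine Finset.sum_lt_sum (fun i _ => ?_) ⟨i₀, Finset.mem_univ _, htan i₀ hi₀⟩
      by_cases hi : v i = w₀ i
      · simp [hi]
      · exact (htan i hi).le
    rwa [Finset.sum_add_distrib, hlin, add_zero] at hlt
  constructor
  · intro hw
    by_contra hne
    exact absurd (hw.2 hmem) (not_le.2 (hstrict w hw.1 hne))
  · rintro rfl
    refine ⟨hmem, fun v hv => ?_⟩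
    by_cases hne : v = w₀
    · simp [hne]
    · exact (hstrict v hv hne).le

theorem abs_dotProduct_le_sum_abs_mul_norm {ι : Type*} [Fintype ι] (v h : ι → ℝ) :
    |v ⬝ᵥ h| ≤ (∑ j, |v j|) * ‖h‖ := by
  rw [Finset.sum_mul]
  refine (Finset.abs_sum_le_sum_abs _ _).trans (Finset.sum_le_sum fun j _ => ?_)
  rw [abs_mul]
  exact mul_le_mul_of_nonneg_left (norm_le_pi_norm h j) (abs_nonneg _)

/-- The equation is the stationarity condition of the convex function `Φ`. Its minimum over a closed
ball exists by compactness; if the gradient at 0 is small compared with curvature times radius, the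
minimizer is interior and so stationary. The norm on `ι → ℝ` is the sup norm, hence the dual `ℓ¹`
sums. -/
theorem exists_dual_solution {α ι : Type*} [Fintype ι] (z : α → ι → ℝ)
    (s : Finset α) (T : ι → ℝ) (u : α → ℝ) {a b r κ : ℝ} (ha : 0 < a) (hr : 0 < r)
    (hu : ∀ i ∈ s, u i ∈ Set.Icc (-b) (-a)) (hq : ∀ i ∈ s, (∑ j, |z i j|) * r ≤ a / 2)
    (hquad : ∀ h : ι → ℝ, κ * ‖h‖ ^ 2 ≤ ∑ i ∈ s, (z i ⬝ᵥ h) ^ 2)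
    (hg : ∑ j, |∑ i ∈ s, crossEntropyInv (u i) * z i j - T j| <
      Real.exp (-(b + a)) / 2 * κ * r) :
    ∃ h : ι → ℝ, ‖h‖ ≤ r ∧ ∑ i ∈ s, crossEntropyInv (u i + z i ⬝ᵥ h) • z i = T := by
  classical
  set Φ : (ι → ℝ) → ℝ := fun h => ∑ i ∈ s, crossEntropyConj (u i + z i ⬝ᵥ h) - T ⬝ᵥ h with hΦ
  have hbd : ∀ h : ι → ℝ, ‖h‖ ≤ r → ∀ i ∈ s, u i + z i ⬝ᵥ h ∈ Set.Ico (-(b + a)) 0 := by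
    intro h hh i hi
    have h1 := (abs_dotProduct_le_sum_abs_mul_norm (z i) h).trans
      ((mul_le_mul_of_nonneg_left hh (Finset.sum_nonneg fun j _ => abs_nonneg _)).trans (hq i hi))
    have h2 := abs_le.1 h1
    have h3 := hu i hi
    exact ⟨by linarith [h3.1, h2.1], by linarith [h3.2, h2.2]⟩
  have hcont : ContinuousOn Φ (Metric.closedBall 0 r) := by
    refine ContinuousOn.sub (continuousOn_finsetSum s fun i hi => ?_)
      (Continuous.continuousOn (by unfold dotProduct; fun_prop))
    intro h hh
    have h1 := (hasDerivAt_crossEntropyConj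
      (hbd h (mem_closedBall_zero_iff.1 hh) i hi).2).continuousAt
    have h2 : Continuous fun h : ι → ℝ => u i + z i ⬝ᵥ h := by unfold dotProduct; fun_prop
    exact (ContinuousAt.comp (f := fun h : ι → ℝ => u i + z i ⬝ᵥ h) h1
      h2.continuousAt).continuousWithinAt
  obtain ⟨h₀, hh₀, hmin⟩ := (isCompact_closedBall (0 : ι → ℝ) r).exists_isMinOn
    ⟨0, Metric.mem_closedBall_self hr.le⟩ hcont
  have hnorm : ‖h₀‖ ≤ r := mem_closedBall_zero_iff.1 hh₀
  -- On the sphere, `Φ h₀ - Φ 0` is at least the curvature term `exp(-(b+a))/2 · κ r²` minus the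
  -- gradient's `ℓ¹` norm times `r`, which is positive by `hg`.
  have hlt : ‖h₀‖ < r := by
    refine lt_of_le_of_ne hnorm fun heq => ?_
    have hle : Φ h₀ ≤ Φ 0 := hmin (Metric.mem_closedBall_self hr.le)
    have hlow : ∑ i ∈ s, (crossEntropyConj (u i) + crossEntropyInv (u i) * (z i ⬝ᵥ h₀) +
        Real.exp (-(b + a)) / 2 * (z i ⬝ᵥ h₀) ^ 2) ≤
        ∑ i ∈ s, crossEntropyConj (u i + z i ⬝ᵥ h₀) := by
      refine Finset.sum_le_sum fun i hi => ?_
      have h1 := hbd h₀ hnorm i hi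
      have h0 := hbd 0 (by simpa using hr.le) i hi
      simp only [dotProduct_zero, add_zero] at h0
      have := crossEntropyConj_lower_bound h0 h1
      simpa using this
    rw [Finset.sum_add_distrib, Finset.sum_add_distrib, ← Finset.mul_sum] at hlow
    have hlin : ∑ i ∈ s, crossEntropyInv (u i) * (z i ⬝ᵥ h₀) - T ⬝ᵥ h₀ =
        (fun j => ∑ i ∈ s, crossEntropyInv (u i) * z i j - T j) ⬝ᵥ h₀ := by
      simp only [dotProduct, sub_mul, Finset.sum_sub_distrib, Finset.mul_sum, Finset.sum_mul]
      rw [Finset.sum_comm]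
      simp only [mul_assoc]
    have hgr := abs_dotProduct_le_sum_abs_mul_norm
      (fun j => ∑ i ∈ s, crossEntropyInv (u i) * z i j - T j) h₀
    rw [← hlin, heq] at hgr
    have hgr' := (abs_le.1 hgr).1
    have hq2 := mul_le_mul_of_nonneg_left (hquad h₀)
      (show 0 ≤ Real.exp (-(b + a)) / 2 by positivity)
    rw [heq] at hq2
    have hg' := mul_lt_mul_of_pos_right hg hr
    simp only [hΦ, dotProduct_zero, add_zero, sub_zero] at hle
    nlinarith
  refine ⟨h₀, hnorm, funext fun j => ?_⟩
  have hd : HasDerivAt (fun t : ℝ => Φ (h₀ + t • Pi.single j 1))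
      (∑ i ∈ s, crossEntropyInv (u i + z i ⬝ᵥ h₀) * z i j - T j) 0 := by
    have hlin : ∀ v : ι → ℝ, ∀ t : ℝ, v ⬝ᵥ (h₀ + t • Pi.single j 1) = v ⬝ᵥ h₀ + t * v j := by
      intro v t
      simp [dotProduct_add, dotProduct_smul]
    simp only [hΦ, hlin]
    refine HasDerivAt.sub (HasDerivAt.fun_sum fun i hi => ?_) ?_
    · have h1 : HasDerivAt (fun t : ℝ => u i + (z i ⬝ᵥ h₀ + t * z i j)) (z i j) 0 := by
        simpa using (((hasDerivAt_id (0 : ℝ)).mul_const (z i j)).const_add (z i ⬝ᵥ h₀)).const_add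
          (u i)
      refine HasDerivAt.comp (h₂ := crossEntropyConj) 0 ?_ h1
      simpa using hasDerivAt_crossEntropyConj (hbd h₀ hnorm i hi).2
    · simpa using ((hasDerivAt_id (0 : ℝ)).mul_const (T j)).const_add (T ⬝ᵥ h₀)
  have hloc : IsLocalMin (fun t : ℝ => Φ (h₀ + t • Pi.single j 1)) 0 := by
    have hc : Continuous fun t : ℝ => h₀ + t • (Pi.single j 1 : ι → ℝ) := by fun_prop
    have hev : ∀ᶠ t : ℝ in 𝓝 0, h₀ + t • (Pi.single j 1 : ι → ℝ) ∈ Metric.ball (0 : ι → ℝ) r :=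
      hc.continuousAt.eventually_mem
        (Metric.isOpen_ball.mem_nhds (by simpa using hlt))
    filter_upwards [hev] with t ht
    simpa using hmin (Metric.ball_subset_closedBall ht)
  have := hloc.hasDerivAt_eq_zero hd
  simp only [Finset.sum_apply, Pi.smul_apply, smul_eq_mul]
  linarith

theorem sum_mul_dotProduct_sq {α ι : Type*} [Fintype ι] (s : Finset α) (w : α → ℝ)
    (z : α → ι → ℝ) (h : ι → ℝ) :
    ∑ i ∈ s, w i * (z i ⬝ᵥ h) ^ 2 =
      ∑ j, ∑ k, h j * h k * ∑ i ∈ s, w i * (z i j * z i k) := by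
  simp only [Finset.mul_sum]
  simp_rw [Finset.sum_comm (t := s)]
  refine Finset.sum_congr rfl fun i _ => ?_
  rw [sq]
  simp only [dotProduct, Finset.sum_mul, Finset.mul_sum]
  rw [Finset.sum_comm]
  refine Finset.sum_congr rfl fun j _ => Finset.sum_congr rfl fun k _ => ?_
  ring

theorem abs_sum_mul_mul_le {ι : Type*} [Fintype ι] (h : ι → ℝ) (D : ι → ι → ℝ) {ε : ℝ}
    (hD : ∀ j k, |D j k| ≤ ε) :
    |∑ j, ∑ k, h j * h k * D j k| ≤ (Fintype.card ι : ℝ) ^ 2 * ε * ‖h‖ ^ 2 := by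
  have h1 : ∀ j k, |h j * h k * D j k| ≤ ‖h‖ ^ 2 * ε := by
    intro j k
    rw [abs_mul, abs_mul, sq]
    have hj := norm_le_pi_norm h j
    have hk := norm_le_pi_norm h k
    rw [Real.norm_eq_abs] at hj hk
    gcongr
    exact hD j k
  calc _ ≤ ∑ j, ∑ k, |h j * h k * D j k| :=
        (Finset.abs_sum_le_sum_abs _ _).trans
          (Finset.sum_le_sum fun j _ => Finset.abs_sum_le_sum_abs _ _)
    _ ≤ ∑ _j : ι, ∑ _k : ι, ‖h‖ ^ 2 * ε :=
        Finset.sum_le_sum fun j _ => Finset.sum_le_sum fun k _ => h1 j k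
    _ = _ := by
        simp only [Finset.sum_const, Finset.card_univ, nsmul_eq_mul]
        ring

theorem log_one_sub_mem_Icc {c₁ c₂ t : ℝ} (hc₁ : 1 < c₁) (hc₂ : 0 < c₂)
    (ht : c₁ < t⁻¹ ∧ t⁻¹ < c₂) :
    Real.log (1 - t) ∈ Set.Icc (Real.log (1 - c₁⁻¹)) (Real.log (1 - c₂⁻¹)) := by
  have h0 : 0 < t := inv_pos.1 (by linarith [ht.1])
  have h1 : t < c₁⁻¹ := (lt_inv_comm₀ (by linarith) h0).1 ht.1
  have h2 : c₂⁻¹ < t := (inv_lt_comm₀ h0 hc₂).1 ht.2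
  have h3 : c₁⁻¹ < 1 := inv_lt_one_of_one_lt₀ hc₁
  exact ⟨Real.log_le_log (by linarith) (by linarith), Real.log_le_log (by linarith) (by linarith)⟩

theorem log_one_sub_inv_neg {c : ℝ} (hc : 1 < c) : Real.log (1 - c⁻¹) < 0 := by
  have h3 : c⁻¹ < 1 := inv_lt_one_of_one_lt₀ hc
  have h4 : 0 < c⁻¹ := inv_pos.2 (by linarith)
  exact Real.log_neg (by linarith) (by linarith)

/-- On samples for which the Horvitz-Thompson estimators of the totals of `z_i` and of `z_i z_i'`
are within `O(√N)` of their means, the dual equation is solved within `O(1/√N)` of the design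
weights. -/
theorem exists_dual_solution_of_concentration (ι : Type*) [Fintype ι] {c₁ c₂ c : ℝ}
    (hc₁ : 1 < c₁) (hc₂ : 1 < c₂) (hc : 0 < c) (B K : ℝ) (hK : 0 ≤ K) :
    ∃ R : ℝ, 0 < R ∧ ∀ᶠ N : ℕ in atTop, ∀ (z : Fin N → ι → ℝ) (π : Fin N → ℝ),
      (∀ i, c₁ < (π i)⁻¹ ∧ (π i)⁻¹ < c₂) →
      (∀ h : ι → ℝ, c * N * ‖h‖ ^ 2 ≤ ∑ i, (z i ⬝ᵥ h) ^ 2) →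
      ∑ i, (∑ j, |z i j|) ^ 4 ≤ B * N →
      ∀ s : Finset (Fin N),
      (∀ j, |∑ i ∈ s, (π i)⁻¹ * z i j - ∑ i, z i j| ≤ K * √N) →
      (∀ j k, |∑ i ∈ s, z i j * z i k - ∑ i, π i * (z i j * z i k)| ≤ K * √N) →
      ∃ h : ι → ℝ, ‖h‖ ≤ R / √N ∧
        (∀ i, (∑ j, |z i j|) * (R / √N) ≤ -Real.log (1 - c₂⁻¹) / 2) ∧
        ∑ i ∈ s, crossEntropyInv (Real.log (1 - π i) + z i ⬝ᵥ h) • z i = ∑ i, z i := by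
  set a := -Real.log (1 - c₂⁻¹) with ha'
  have ha : 0 < a := neg_pos.2 (log_one_sub_inv_neg hc₂)
  set b := -Real.log (1 - c₁⁻¹) with hb'
  set m := Real.exp (-(b + a)) / 2 with hm'
  have hm : 0 < m := by positivity
  set p : ℝ := (Fintype.card ι : ℝ) with hp'
  have hp : 0 ≤ p := Nat.cast_nonneg _
  have hc₂0 : 0 < c₂ := by linarith
  -- Chosen so that `m · (c N / (2 c₂)) · (R / √N) = (p K + 1) √N`, which strictly exceeds the bound
  -- `p K √N` on the gradient.
  set R := (p * K + 1) * (2 * c₂) / (m * c) with hR'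
  have hR : 0 < R := by positivity
  have hN : Tendsto (fun N : ℕ => (N : ℝ)) atTop atTop := tendsto_natCast_atTop_atTop
  have hsqrt : Tendsto (fun N : ℕ => √(N : ℝ)) atTop atTop := Real.tendsto_sqrt_atTop.comp hN
  refine ⟨R, hR, ?_⟩
  filter_upwards [hN.eventually_ge_atTop (R ^ 4 * B / (a / 2) ^ 4), hN.eventually_gt_atTop 0,
    hsqrt.eventually_ge_atTop (p ^ 2 * K / (c / (2 * c₂)))] with N hN1 hN0 hN2
  intro z π hd hS hB s hg hH
  have hsN : 0 < √(N : ℝ) := Real.sqrt_pos.2 hN0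
  have hsq : √(N : ℝ) * √(N : ℝ) = N := Real.mul_self_sqrt hN0.le
  have hπ0 : ∀ i, 0 < π i := fun i => inv_pos.1 (by linarith [(hd i).1])
  have hπ2 : ∀ i, c₂⁻¹ ≤ π i := fun i => ((inv_lt_comm₀ (hπ0 i) hc₂0).1 (hd i).2).le
  have hπ1 : ∀ i, π i < 1 := fun i => by
    have h2 : c₁⁻¹ < 1 := inv_lt_one_of_one_lt₀ hc₁
    have h3 := (lt_inv_comm₀ (by linarith) (hπ0 i)).1 (hd i).1
    linarith
  -- A single term is bounded by the whole fourth-moment sum, so the largest `∑ j, |z i j|` is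
  -- `O(N^{1/4})`, negligible against `√N`.
  have hq : ∀ i, (∑ j, |z i j|) * (R / √N) ≤ a / 2 := by
    intro i
    have hq4 : (∑ j, |z i j|) ^ 4 ≤ B * N :=
      (Finset.single_le_sum (f := fun i => (∑ j, |z i j|) ^ 4) (fun i _ => by positivity)
        (Finset.mem_univ i)).trans hB
    refine le_of_pow_le_pow_left₀ (n := 4) (by norm_num) (by positivity) ?_
    have hs4 : √(N : ℝ) ^ 4 = N * N := by
      calc _ = (√(N : ℝ) * √(N : ℝ)) * (√(N : ℝ) * √(N : ℝ)) := by ring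
        _ = _ := by rw [hsq]
    have h1 : R ^ 4 * B ≤ (a / 2) ^ 4 * N := by
      rw [div_le_iff₀ (by positivity)] at hN1
      linarith
    rw [mul_pow, div_pow, hs4, ← mul_div_assoc, div_le_iff₀ (by positivity)]
    have h2 := mul_le_mul_of_nonneg_right hq4 (show 0 ≤ R ^ 4 by positivity)
    have h3 := mul_le_mul_of_nonneg_right h1 hN0.le
    linarith
  -- The expected sample Gram matrix is at least `c N / c₂` in quadratic form, as `π_i ≥ 1 / c₂`;
  -- the fluctuation `p² K √N` uses up at most half of it.
  have hquad : ∀ h : ι → ℝ, c / (2 * c₂) * N * ‖h‖ ^ 2 ≤ ∑ i ∈ s, (z i ⬝ᵥ h) ^ 2 := by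
    intro h
    have h1 := sum_mul_dotProduct_sq s (fun _ => 1) z h
    have h2 := sum_mul_dotProduct_sq Finset.univ π z h
    simp only [one_mul] at h1
    have h3 := abs_sum_mul_mul_le h _ hH
    simp only [mul_sub, Finset.sum_sub_distrib] at h3
    rw [← h1, ← h2] at h3
    have h4 : c₂⁻¹ * ∑ i, (z i ⬝ᵥ h) ^ 2 ≤ ∑ i, π i * (z i ⬝ᵥ h) ^ 2 := by
      rw [Finset.mul_sum]
      exact Finset.sum_le_sum fun i _ => mul_le_mul_of_nonneg_right (hπ2 i) (sq_nonneg _)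
    have h5 := mul_le_mul_of_nonneg_left (hS h) (inv_pos.2 hc₂0).le
    have h6 : p ^ 2 * K * √N ≤ c / (2 * c₂) * N := by
      rw [div_le_iff₀ (by positivity)] at hN2
      have := mul_le_mul_of_nonneg_right hN2 hsN.le
      have h10 : √(N : ℝ) * (c / (2 * c₂)) * √N = c / (2 * c₂) * (√N * √N) := by ring
      rwa [h10, hsq] at this
    have h7 := mul_le_mul_of_nonneg_right h6 (sq_nonneg ‖h‖)
    have h8 : c₂⁻¹ * (c * N * ‖h‖ ^ 2) = 2 * (c / (2 * c₂) * N * ‖h‖ ^ 2) := by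
      field_simp
    have h9 := (abs_le.1 h3).1
    nlinarith
  have hgrad : ∑ j, |∑ i ∈ s, crossEntropyInv (Real.log (1 - π i)) * z i j - (∑ i, z i) j| <
      m * (c / (2 * c₂) * N) * (R / √N) := by
    have h1 : ∀ j, |∑ i ∈ s, crossEntropyInv (Real.log (1 - π i)) * z i j - (∑ i, z i) j| ≤
        K * √N := by
      intro j
      simp only [crossEntropyInv_log (hπ1 _), Finset.sum_apply]
      exact hg j
    calc _ ≤ ∑ _j : ι, K * √N := Finset.sum_le_sum fun j _ => h1 j
      _ = p * K * √N := by
        simp only [Finset.sum_const, Finset.card_univ, nsmul_eq_mul, hp']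
        ring
      _ < (p * K + 1) * √N := by nlinarith
      _ = m * (c / (2 * c₂) * (√N * √N)) * (R / √N) := by
        rw [hR']
        field_simp
      _ = _ := by rw [hsq]
  obtain ⟨h, hh, hsol⟩ := exists_dual_solution z s (∑ i, z i) (fun i => Real.log (1 - π i))
    (a := a) (b := b) (r := R / √N) (κ := c / (2 * c₂) * N) ha (by positivity)
    (fun i _ => by
      have := log_one_sub_mem_Icc hc₁ hc₂0 (hd i)
      simpa [ha', hb'] using this)
    (fun i _ => hq i) hquad hgrad
  exact ⟨h, hh, hq, hsol⟩

/-- First-order expansion of the calibrated total in the dual variable. -/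
theorem abs_sum_crossEntropyInv_sub_mul_le {α ι : Type*} [Fintype α] [Fintype ι]
    (z : α → ι → ℝ) (u e : α → ℝ) (s : Finset α) (h : ι → ℝ) {a r G E : ℝ} (ha : 0 < a)
    (hr : ‖h‖ ≤ r) (hu : ∀ i, u i ≤ -(2 * a)) (hq : ∀ i, (∑ j, |z i j|) * r ≤ a)
    (hG : ∀ j, |∑ i ∈ s, crossEntropyInv (u i) * (crossEntropyInv (u i) - 1) * (z i j * e i)| ≤ G)
    (hE : ∑ i, (∑ j, |z i j|) ^ 2 * |e i| ≤ E) :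
    |∑ i ∈ s, (crossEntropyInv (u i + z i ⬝ᵥ h) - crossEntropyInv (u i)) * e i| ≤
      Fintype.card ι * G * r + crossEntropyInv (-a) ^ 3 * r ^ 2 * E := by
  have hr0 : 0 ≤ r := (norm_nonneg h).trans hr
  have hzh : ∀ i, |z i ⬝ᵥ h| ≤ (∑ j, |z i j|) * r := fun i =>
    (abs_dotProduct_le_sum_abs_mul_norm (z i) h).trans
      (mul_le_mul_of_nonneg_left hr (Finset.sum_nonneg fun j _ => abs_nonneg _))
  have hC : 0 ≤ crossEntropyInv (-a) ^ 3 := by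
    have := one_lt_crossEntropyInv (neg_lt_zero.2 ha)
    positivity
  have hrem : ∀ i, |(crossEntropyInv (u i + z i ⬝ᵥ h) - crossEntropyInv (u i) -
      crossEntropyInv (u i) * (crossEntropyInv (u i) - 1) * (z i ⬝ᵥ h)) * e i| ≤
      crossEntropyInv (-a) ^ 3 * r ^ 2 * ((∑ j, |z i j|) ^ 2 * |e i|) := by
    intro i
    have h1 := abs_le.1 ((hzh i).trans (hq i))
    have h2 := crossEntropyInv_taylor ha (u := u i) (v := u i + z i ⬝ᵥ h)
      (by linarith [hu i]) (by linarith [hu i, h1.2])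
    rw [add_sub_cancel_left] at h2
    rw [abs_mul]
    have h3 : (z i ⬝ᵥ h) ^ 2 ≤ ((∑ j, |z i j|) * r) ^ 2 := by
      rw [← sq_abs]
      exact pow_le_pow_left₀ (abs_nonneg _) (hzh i) 2
    calc _ ≤ crossEntropyInv (-a) ^ 3 * ((∑ j, |z i j|) * r) ^ 2 * |e i| := by
          gcongr
          exact h2.trans (mul_le_mul_of_nonneg_left h3 hC)
      _ = _ := by ring
  have hlin : ∑ i ∈ s, crossEntropyInv (u i) * (crossEntropyInv (u i) - 1) * (z i ⬝ᵥ h) * e i =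
      (fun j => ∑ i ∈ s, crossEntropyInv (u i) * (crossEntropyInv (u i) - 1) * (z i j * e i))
        ⬝ᵥ h := by
    simp only [dotProduct, Finset.mul_sum, Finset.sum_mul]
    rw [Finset.sum_comm]
    refine Finset.sum_congr rfl fun j _ => Finset.sum_congr rfl fun i _ => ?_
    ring
  have hsplit : ∑ i ∈ s, (crossEntropyInv (u i + z i ⬝ᵥ h) - crossEntropyInv (u i)) * e i =
      ∑ i ∈ s, crossEntropyInv (u i) * (crossEntropyInv (u i) - 1) * (z i ⬝ᵥ h) * e i +
      ∑ i ∈ s, (crossEntropyInv (u i + z i ⬝ᵥ h) - crossEntropyInv (u i) -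
        crossEntropyInv (u i) * (crossEntropyInv (u i) - 1) * (z i ⬝ᵥ h)) * e i := by
    rw [← Finset.sum_add_distrib]
    refine Finset.sum_congr rfl fun i _ => ?_
    ring
  rw [hsplit, hlin]
  refine (abs_add_le _ _).trans (add_le_add ?_ ?_)
  · refine (abs_dotProduct_le_sum_abs_mul_norm _ h).trans ?_
    refine mul_le_mul ?_ hr (norm_nonneg _) ?_
    · refine (Finset.sum_le_sum fun j _ => hG j).trans ?_
      simp
    -- Nonnegativity of `G` follows from `hG` only if there is an index; otherwise the factor
    -- `Fintype.card ι` is zero.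
    · by_cases hι : Nonempty ι
      · obtain ⟨j⟩ := hι
        have := (abs_nonneg _).trans (hG j)
        positivity
      · rw [not_nonempty_iff] at hι
        simp
  · refine (Finset.abs_sum_le_sum_abs _ _).trans ?_
    refine (Finset.sum_le_sum fun i _ => hrem i).trans ?_
    rw [← Finset.mul_sum]
    refine mul_le_mul_of_nonneg_left ?_ (by positivity)
    exact (Finset.sum_le_univ_sum_of_nonneg fun i => by positivity).trans hE

/-! ### Moments of sample totals under a general design -/

section Design

variable {Ω : Type*} [MeasurableSpace Ω] {P : Measure Ω} {N : ℕ} {A : Ω → Finset (Fin N)}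

/-- The sample takes finitely many values and each has a measurable preimage. Any function of the
sample is therefore measurable, and being bounded it has all moments. -/
theorem measurable_comp_sample (hA : ∀ i, MeasurableSet {ω | i ∈ A ω})
    (φ : Finset (Fin N) → ℝ) : Measurable fun ω => φ (A ω) := by
  let _ : MeasurableSpace (Finset (Fin N)) := ⊤
  have : Measurable A := by
    refine measurable_to_countable' fun s => ?_
    have h : A ⁻¹' {s} = ⋂ i, {ω | i ∈ A ω ↔ i ∈ s} := by
      ext ω
      simp [Finset.ext_iff]
    rw [h]
    refine MeasurableSet.iInter fun i => ?_
    by_cases hi : i ∈ s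
    · simpa [hi] using hA i
    · have h1 : {ω | i ∈ A ω ↔ i ∈ s} = {ω | i ∈ A ω}ᶜ := by
        ext ω
        simp [hi]
      rw [h1]
      exact (hA i).compl
  exact (measurable_from_top (f := φ)).comp this

theorem sum_sample_eq (s : Finset (Fin N)) (v : Fin N → ℝ) :
    ∑ i ∈ s, v i = ∑ i, v i * (if i ∈ s then 1 else 0) := by
  simp

theorem integral_inclusion_indicator {Q : Ω → Prop} [DecidablePred Q]
    (hQ : MeasurableSet {ω | Q ω}) :
    ∫ ω, (if Q ω then (1 : ℝ) else 0) ∂P = P.real {ω | Q ω} := by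
  rw [← integral_indicator_one hQ]
  refine integral_congr_ae (ae_of_all _ fun ω => ?_)
  by_cases h : Q ω <;> simp [h]

variable [IsProbabilityMeasure P]

theorem memLp_comp_sample (hA : ∀ i, MeasurableSet {ω | i ∈ A ω})
    (φ : Finset (Fin N) → ℝ) (q : ENNReal) : MemLp (fun ω => φ (A ω)) q P := by
  refine MemLp.of_bound (measurable_comp_sample hA φ).aestronglyMeasurable (∑ s, |φ s|)
    (ae_of_all _ fun ω => ?_)
  rw [Real.norm_eq_abs]
  exact Finset.single_le_sum (f := fun s => |φ s|) (fun s _ => abs_nonneg _)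
    (Finset.mem_univ (A ω))

theorem integrable_comp_sample (hA : ∀ i, MeasurableSet {ω | i ∈ A ω})
    (φ : Finset (Fin N) → ℝ) : Integrable (fun ω => φ (A ω)) P :=
  memLp_one_iff_integrable.1 (memLp_comp_sample hA φ 1)

theorem measurableSet_sample (hA : ∀ i, MeasurableSet {ω | i ∈ A ω})
    (Q : Finset (Fin N) → Prop) : MeasurableSet {ω | Q (A ω)} := by
  classical
  have h := measurable_comp_sample hA (fun s => if Q s then (1 : ℝ) else 0)
    (measurableSet_singleton (1 : ℝ))
  convert h using 1
  ext ω
  simp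

variable {π : Fin N → ℝ}

theorem integral_sum_sample (hA : ∀ i, MeasurableSet {ω | i ∈ A ω})
    (hπ : ∀ i, π i = P.real {ω | i ∈ A ω}) (v : Fin N → ℝ) :
    ∫ ω, ∑ i ∈ A ω, v i ∂P = ∑ i, π i * v i := by
  simp only [sum_sample_eq (A _) v]
  rw [integral_finsetSum]
  · refine Finset.sum_congr rfl fun i _ => ?_
    rw [integral_const_mul, integral_inclusion_indicator (hA i), hπ i, mul_comm]
  · intro i _
    exact integrable_comp_sample hA (fun s => v i * if i ∈ s then 1 else 0)

theorem covariance_sum_sample (hA : ∀ i, MeasurableSet {ω | i ∈ A ω}) (v w : Fin N → ℝ) :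
    cov[fun ω => ∑ i ∈ A ω, v i, fun ω => ∑ i ∈ A ω, w i; P] =
      ∑ i, ∑ j, v i * w j * cov[fun ω => if i ∈ A ω then (1 : ℝ) else 0,
        fun ω => if j ∈ A ω then (1 : ℝ) else 0; P] := by
  simp only [sum_sample_eq (A _)]
  rw [covariance_fun_sum_fun_sum
    (fun i => memLp_comp_sample hA (fun s => v i * if i ∈ s then 1 else 0) 2)
    (fun i => memLp_comp_sample hA (fun s => w i * if i ∈ s then 1 else 0) 2)]
  refine Finset.sum_congr rfl fun i _ => Finset.sum_congr rfl fun j _ => ?_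
  rw [covariance_const_mul_left, covariance_const_mul_right, mul_assoc]

theorem covariance_inclusion (hA : ∀ i, MeasurableSet {ω | i ∈ A ω})
    (hπ : ∀ i, π i = P.real {ω | i ∈ A ω}) (i j : Fin N) :
    cov[fun ω => if i ∈ A ω then (1 : ℝ) else 0,
        fun ω => if j ∈ A ω then (1 : ℝ) else 0; P] =
      P.real {ω | i ∈ A ω ∧ j ∈ A ω} - π i * π j := by
  rw [covariance_eq_sub (memLp_comp_sample hA (fun s => if i ∈ s then 1 else 0) 2)
    (memLp_comp_sample hA (fun s => if j ∈ s then 1 else 0) 2),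
    integral_inclusion_indicator (hA i), integral_inclusion_indicator (hA j), ← hπ, ← hπ,
    ← integral_inclusion_indicator (Q := fun ω => i ∈ A ω ∧ j ∈ A ω) ((hA i).inter (hA j))]
  congr 2
  ext ω
  by_cases h1 : i ∈ A ω <;> by_cases h2 : j ∈ A ω <;> simp [h1, h2]

/-- Diagonal covariances are at most 1 in absolute value and the others at most `M / N`;
Cauchy-Schwarz `(∑ |v i|)² ≤ N ∑ v i²` absorbs the factor `1 / N`. -/
theorem variance_sum_sample_le (hA : ∀ i, MeasurableSet {ω | i ∈ A ω})
    (hπ : ∀ i, π i = P.real {ω | i ∈ A ω}) {M : ℝ} (hM : 0 ≤ M)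
    (hΔ : ∀ i j, i ≠ j →
      (N : ℝ) * |P.real {ω | i ∈ A ω ∧ j ∈ A ω} - π i * π j| ≤ M) (v : Fin N → ℝ) :
    Var[fun ω => ∑ i ∈ A ω, v i; P] ≤ (1 + M) * ∑ i, v i ^ 2 := by
  rcases Nat.eq_zero_or_pos N with rfl | hN
  · have : (fun ω => ∑ i ∈ A ω, v i) = fun _ => (0 : ℝ) := by
      ext ω
      refine Finset.sum_eq_zero fun i _ => i.elim0
    rw [this, ← covariance_self aemeasurable_const]
    simp
  have hN' : (0 : ℝ) < N := by exact_mod_cast hN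
  have hdiag : ∀ i j, P.real {ω | i ∈ A ω ∧ j ∈ A ω} - π i * π j ≤
      (if i = j then 1 else 0) + M / N ∧
      -((if i = j then 1 else 0) + M / N) ≤ P.real {ω | i ∈ A ω ∧ j ∈ A ω} - π i * π j := by
    intro i j
    by_cases hij : i = j
    · have h0 : 0 ≤ M / N := by positivity
      have hp0 : ∀ k, 0 ≤ π k := fun k => by rw [hπ]; exact measureReal_nonneg
      have hp1 : ∀ k, π k ≤ 1 := fun k => by rw [hπ]; exact measureReal_le_one
      have h1 : P.real {ω | i ∈ A ω ∧ j ∈ A ω} ≤ 1 := measureReal_le_one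
      have h2 : 0 ≤ P.real {ω | i ∈ A ω ∧ j ∈ A ω} := measureReal_nonneg
      have h3 := mul_nonneg (hp0 i) (hp0 j)
      have h4 := mul_le_one₀ (hp1 i) (hp0 j) (hp1 j)
      simp only [if_pos hij]
      constructor <;> linarith
    · have h := hΔ i j hij
      rw [mul_comm, ← le_div_iff₀ hN'] at h
      have h' := abs_le.1 h
      simp only [if_neg hij, zero_add]
      exact ⟨h'.2, h'.1⟩
  have hcs : (∑ i, |v i|) ^ 2 ≤ N * ∑ i, v i ^ 2 := by
    have := sq_sum_le_card_mul_sum_sq (s := Finset.univ) (f := fun i => |v i|)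
    simpa using this
  rw [← covariance_self (measurable_comp_sample hA fun s => ∑ i ∈ s, v i).aemeasurable,
    covariance_sum_sample hA]
  simp only [covariance_inclusion hA hπ]
  calc _ ≤ ∑ i, ∑ j, |v i| * |v j| * ((if i = j then 1 else 0) + M / N) := by
        refine Finset.sum_le_sum fun i _ => Finset.sum_le_sum fun j _ => ?_
        refine (le_abs_self _).trans ?_
        rw [abs_mul, abs_mul]
        exact mul_le_mul_of_nonneg_left (abs_le.2 ⟨(hdiag i j).2, (hdiag i j).1⟩) (by positivity)
    _ = ∑ i, v i ^ 2 + M / N * (∑ i, |v i|) ^ 2 := by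
        simp only [mul_add, Finset.sum_add_distrib]
        congr 1
        · simp [← sq]
        · rw [sq, Finset.sum_mul_sum, Finset.mul_sum]
          refine Finset.sum_congr rfl fun i _ => ?_
          rw [Finset.mul_sum]
          exact Finset.sum_congr rfl fun j _ => by ring
    _ ≤ ∑ i, v i ^ 2 + M / N * (N * ∑ i, v i ^ 2) := by gcongr
    _ = _ := by field_simp

/-- Poisson sampling: Horvitz-Thompson covariances. -/
theorem covariance_sum_sample_of_indep (hA : ∀ i, MeasurableSet {ω | i ∈ A ω})
    (hπ : ∀ i, π i = P.real {ω | i ∈ A ω})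
    (hind : iIndepFun (fun i ω => if i ∈ A ω then (1 : ℝ) else 0) P) (v w : Fin N → ℝ) :
    cov[fun ω => ∑ i ∈ A ω, v i, fun ω => ∑ i ∈ A ω, w i; P] =
      ∑ i, π i * (1 - π i) * (v i * w i) := by
  rw [covariance_sum_sample hA]
  refine Finset.sum_congr rfl fun i _ => ?_
  rw [Finset.sum_eq_single i]
  · rw [covariance_inclusion hA hπ]
    simp only [and_self, ← hπ]
    ring
  · intro j _ hj
    rw [(hind.indepFun hj.symm).covariance_eq_zero
      (memLp_comp_sample hA (fun s => if i ∈ s then 1 else 0) 2)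
      (memLp_comp_sample hA (fun s => if j ∈ s then 1 else 0) 2), mul_zero]
  · simp

end Design

/-- Simultaneous Chebyshev bound for finitely many sample totals. -/
theorem exists_uniform_chebyshev (κ : Type*) [Fintype κ] (B : ℝ) {ε : ℝ} (hε : 0 < ε) :
    ∃ K : ℝ, 0 ≤ K ∧ ∀ {Ω : Type*} [MeasurableSpace Ω] (P : Measure Ω) [IsProbabilityMeasure P]
      {N : ℕ} (A : Ω → Finset (Fin N)) (π : Fin N → ℝ), 0 < N →
      (∀ i, MeasurableSet {ω | i ∈ A ω}) → (∀ i, π i = P.real {ω | i ∈ A ω}) →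
      ∀ v : κ → Fin N → ℝ, (∀ k, Var[fun ω => ∑ i ∈ A ω, v k i; P] ≤ B * N) →
      P.real {ω | ¬ ∀ k, |∑ i ∈ A ω, v k i - ∑ i, π i * v k i| ≤ K * √N} ≤ ε := by
  -- Makes the union bound `card κ · |B| / K²` at most `ε`; the `+ 1` keeps `K` positive. It depends
  -- on neither the design nor the population, hence is uniform along the sequence.
  set K := √(Fintype.card κ * |B| / ε) + 1 with hK
  have hK0 : 0 < K := by positivity
  refine ⟨K, hK0.le, ?_⟩
  intro Ω _ P _ N A π hN hA hπ v hv
  have hN' : (0 : ℝ) < N := by exact_mod_cast hN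
  have hsq : √(N : ℝ) ^ 2 = N := Real.sq_sqrt hN'.le
  have hpos : 0 < K * √N := by positivity
  have hone : ∀ k, P.real {ω | K * √N ≤ |∑ i ∈ A ω, v k i - ∑ i, π i * v k i|} ≤
      |B| / K ^ 2 := by
    intro k
    have h := meas_ge_le_variance_div_sq (memLp_comp_sample (P := P) hA
      (fun s => ∑ i ∈ s, v k i) 2) hpos
    rw [integral_sum_sample hA hπ] at h
    have h1 := ENNReal.toReal_le_of_le_ofReal
      (div_nonneg (variance_nonneg _ _) (sq_nonneg _)) h
    refine h1.trans ?_
    rw [mul_pow, hsq, div_le_div_iff₀ (by positivity) (by positivity)]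
    have h2 := (hv k).trans (mul_le_mul_of_nonneg_right (le_abs_self B) hN'.le)
    have h3 := mul_le_mul_of_nonneg_right h2 (sq_nonneg K)
    linarith
  have hsub : {ω | ¬ ∀ k, |∑ i ∈ A ω, v k i - ∑ i, π i * v k i| ≤ K * √N} ⊆
      ⋃ k, {ω | K * √N ≤ |∑ i ∈ A ω, v k i - ∑ i, π i * v k i|} := by
    intro ω hω
    obtain ⟨k, hk⟩ := not_forall.1 hω
    exact Set.mem_iUnion.2 ⟨k, (not_le.1 hk).le⟩
  calc _ ≤ ∑ k, P.real {ω | K * √N ≤ |∑ i ∈ A ω, v k i - ∑ i, π i * v k i|} :=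
        (measureReal_mono hsub).trans (measureReal_iUnion_fintype_le _)
    _ ≤ ∑ _k : κ, |B| / K ^ 2 := Finset.sum_le_sum fun k _ => hone k
    _ = Fintype.card κ * |B| / K ^ 2 := by
        simp [mul_div_assoc]
    _ ≤ ε := by
        rw [div_le_iff₀ (by positivity)]
        have h1 : Fintype.card κ * |B| / ε ≤ K ^ 2 := by
          have h2 := Real.sq_sqrt (show 0 ≤ Fintype.card κ * |B| / ε by positivity)
          have h3 := Real.sqrt_nonneg (Fintype.card κ * |B| / ε)
          rw [hK]
          nlinarith
        rw [div_le_iff₀ hε] at h1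
        linarith

theorem sq_mul_abs_le (q e : ℝ) : q ^ 2 * |e| ≤ q ^ 4 + 1 + e ^ 4 := by
  have h1 : |e| ^ 2 = e ^ 2 := sq_abs e
  nlinarith [sq_nonneg (q ^ 2 - |e|), sq_nonneg (e ^ 2 - 1), sq_nonneg (q ^ 2), sq_nonneg (e ^ 2)]

theorem abs_le_sum_abs {ι : Type*} [Fintype ι] (v : ι → ℝ) (j : ι) : |v j| ≤ ∑ k, |v k| :=
  Finset.single_le_sum (f := fun k => |v k|) (fun _ _ => abs_nonneg _) (Finset.mem_univ j)

/-! ### Stochastic order of the calibration correction -/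

/-- The orthogonality `he₀` centers the linear coefficient of the expansion, which brings the
correction down from `O_p(√N)` to `O_p(1)`. Stated for general `e`: zero residuals give existence of
the weights, optimal residuals give the expansion. -/
theorem calibration_bounded_in_probability {ι : Type*} [Fintype ι]
    (N : ℕ → ℕ) (hN : Tendsto N atTop atTop) (z : ∀ ν, Fin (N ν) → ι → ℝ)
    (e : ∀ ν, Fin (N ν) → ℝ) {Ω : ℕ → Type*} [∀ ν, MeasurableSpace (Ω ν)]
    (P : ∀ ν, Measure (Ω ν)) [∀ ν, IsProbabilityMeasure (P ν)]
    (A : ∀ ν, Ω ν → Finset (Fin (N ν))) (hA : ∀ ν i, MeasurableSet {ω | i ∈ A ν ω})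
    (π : ∀ ν, Fin (N ν) → ℝ) (hπ : ∀ ν i, π ν i = (P ν).real {ω | i ∈ A ν ω})
    {c₁ c₂ : ℝ} (hc₁ : 1 < c₁) (hc₂ : 1 < c₂)
    (hd : ∀ ν i, c₁ < (π ν i)⁻¹ ∧ (π ν i)⁻¹ < c₂)
    (hΔ : ∃ M : ℝ, ∀ᶠ ν in atTop, ∀ i j, i ≠ j →
      (N ν : ℝ) * |(P ν).real {ω | i ∈ A ν ω ∧ j ∈ A ν ω} - π ν i * π ν j| ≤ M)
    (l₀ : ι → ℝ) (hl₀ : ∀ ν i, z ν i ⬝ᵥ l₀ = Real.log (1 - π ν i))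
    {c B : ℝ} (hc : 0 < c)
    (hS : ∀ᶠ ν in atTop, ∀ h : ι → ℝ, c * N ν * ‖h‖ ^ 2 ≤ ∑ i, (z ν i ⬝ᵥ h) ^ 2)
    (hq : ∀ᶠ ν in atTop, ∑ i, (∑ j, |z ν i j|) ^ 4 ≤ B * N ν)
    (he : ∀ᶠ ν in atTop, ∑ i, e ν i ^ 4 ≤ B * N ν)
    (he₀ : ∀ᶠ ν in atTop, ∀ j, ∑ i, ((π ν i)⁻¹ - 1) * (z ν i j * e ν i) = 0)
    {ε : ℝ} (hε : 0 < ε) :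
    ∃ D : ℝ, ∀ᶠ ν in atTop, (P ν).real {ω | ¬ ∃ lam : ι → ℝ,
      (∀ i ∈ A ν ω, z ν i ⬝ᵥ lam < 0) ∧
      ∑ i ∈ A ν ω, crossEntropyInv (z ν i ⬝ᵥ lam) • z ν i = ∑ i, z ν i ∧
      |∑ i ∈ A ν ω, (crossEntropyInv (z ν i ⬝ᵥ lam) - (π ν i)⁻¹) * e ν i| ≤ D} ≤ ε := by
  obtain ⟨M, hM⟩ := hΔ
  obtain ⟨K, hK, hcheb⟩ := exists_uniform_chebyshev (ι ⊕ (ι × ι) ⊕ ι)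
    ((1 + |M|) * (c₂ ^ 4 * (1 + 2 * B))) hε
  obtain ⟨R, hR, hdual⟩ := exists_dual_solution_of_concentration ι hc₁ hc₂ hc B K hK
  set a := -Real.log (1 - c₂⁻¹) / 2 with ha'
  have ha : 0 < a := half_pos (neg_pos.2 (log_one_sub_inv_neg hc₂))
  refine ⟨Fintype.card ι * K * R + crossEntropyInv (-a) ^ 3 * R ^ 2 * (2 * B + 1), ?_⟩
  filter_upwards [hM, hS, hq, he, he₀, hN.eventually hdual, hN.eventually_gt_atTop 0]
    with ν hM hS hq he he₀ hdual hN0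
  have hN0' : (0 : ℝ) < N ν := by exact_mod_cast hN0
  have hsN : 0 < √(N ν : ℝ) := Real.sqrt_pos.2 hN0'
  have hsq : √(N ν : ℝ) ^ 2 = N ν := Real.sq_sqrt hN0'.le
  have hπ0 : ∀ i, 0 < π ν i := fun i => inv_pos.1 (by linarith [(hd ν i).1])
  have hπ1 : ∀ i, π ν i < 1 := fun i => by
    have h3 := (one_lt_inv₀ (hπ0 i)).1 (hc₁.trans (hd ν i).1)
    exact h3
  set q : Fin (N ν) → ℝ := fun i => ∑ j, |z ν i j| with hqdef
  have hzq : ∀ i j, |z ν i j| ≤ q i := fun i j => abs_le_sum_abs (z ν i) j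
  have hq0 : ∀ i, 0 ≤ q i := fun i => Finset.sum_nonneg fun j _ => abs_nonneg _
  -- One Chebyshev event controls three families: the dual gradient at `λ₀`, the sample Gram matrix,
  -- and the linear coefficient of the expansion.
  set v : ι ⊕ (ι × ι) ⊕ ι → Fin (N ν) → ℝ := fun k i =>
    Sum.elim (fun j => (π ν i)⁻¹ * z ν i j) (Sum.elim (fun jk => z ν i jk.1 * z ν i jk.2)
      (fun j => (π ν i)⁻¹ * ((π ν i)⁻¹ - 1) * (z ν i j * e ν i))) k with hv
  have hvsq : ∀ k i, v k i ^ 2 ≤ c₂ ^ 4 * (1 + q i ^ 4 + e ν i ^ 4) := by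
    intro k i
    have hd1 : 1 < (π ν i)⁻¹ := hc₁.trans (hd ν i).1
    have hd2 := (hd ν i).2
    have hc2 : 1 ≤ c₂ ^ 2 := one_le_pow₀ hc₂.le
    have hc24 : c₂ ^ 2 ≤ c₂ ^ 4 := pow_le_pow_right₀ hc₂.le (by norm_num)
    have hz2 : ∀ j, z ν i j ^ 2 ≤ q i ^ 2 := fun j => by
      rw [← sq_abs]
      exact pow_le_pow_left₀ (abs_nonneg _) (hzq i j) 2
    have hds : (π ν i)⁻¹ ^ 2 ≤ c₂ ^ 2 := pow_le_pow_left₀ (by linarith) hd2.le 2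
    have hds' : ((π ν i)⁻¹ - 1) ^ 2 ≤ c₂ ^ 2 := pow_le_pow_left₀ (by linarith) (by linarith) 2
    have hq4 : q i ^ 2 * q i ^ 2 = q i ^ 4 := by ring
    have he4 : 0 ≤ e ν i ^ 4 := by positivity
    rcases k with j | ⟨j, k⟩ | j
    · calc v (Sum.inl j) i ^ 2 = (π ν i)⁻¹ ^ 2 * z ν i j ^ 2 := by simp only [hv, Sum.elim_inl]; ring
        _ ≤ c₂ ^ 4 * q i ^ 2 := mul_le_mul (hds.trans hc24) (hz2 j) (sq_nonneg _) (by positivity)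
        _ ≤ _ := by
          gcongr
          nlinarith [sq_nonneg (q i ^ 2 - 1)]
    · calc v (Sum.inr (Sum.inl (j, k))) i ^ 2 = z ν i j ^ 2 * z ν i k ^ 2 := by
            simp only [hv, Sum.elim_inl, Sum.elim_inr]; ring
        _ ≤ q i ^ 2 * q i ^ 2 := mul_le_mul (hz2 j) (hz2 k) (sq_nonneg _) (sq_nonneg _)
        _ ≤ 1 * (1 + q i ^ 4 + e ν i ^ 4) := by linarith
        _ ≤ _ := by gcongr; linarith
    · calc v (Sum.inr (Sum.inr j)) i ^ 2 =
            ((π ν i)⁻¹ ^ 2 * ((π ν i)⁻¹ - 1) ^ 2) * (z ν i j ^ 2 * e ν i ^ 2) := by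
            simp only [hv, Sum.elim_inr]; ring
        _ ≤ (c₂ ^ 2 * c₂ ^ 2) * (q i ^ 2 * e ν i ^ 2) :=
            mul_le_mul (mul_le_mul hds hds' (sq_nonneg _) (by positivity))
              (mul_le_mul_of_nonneg_right (hz2 j) (sq_nonneg _)) (by positivity) (by positivity)
        _ = c₂ ^ 4 * (q i ^ 2 * e ν i ^ 2) := by ring
        _ ≤ _ := by
          gcongr
          nlinarith [sq_nonneg (q i ^ 2 - e ν i ^ 2)]
  have hvar : ∀ k, Var[fun ω => ∑ i ∈ A ν ω, v k i; P ν] ≤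
      (1 + |M|) * (c₂ ^ 4 * (1 + 2 * B)) * N ν := by
    intro k
    refine (variance_sum_sample_le (hA ν) (hπ ν) (abs_nonneg M)
      (fun i j hij => (hM i j hij).trans (le_abs_self M)) (v k)).trans ?_
    rw [mul_assoc]
    refine mul_le_mul_of_nonneg_left ?_ (by positivity)
    refine (Finset.sum_le_sum fun i _ => hvsq k i).trans ?_
    rw [← Finset.mul_sum, Finset.sum_add_distrib, Finset.sum_add_distrib, mul_assoc]
    refine mul_le_mul_of_nonneg_left ?_ (by positivity)
    simp only [Finset.sum_const, Finset.card_univ, Fintype.card_fin, nsmul_eq_mul]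
    linarith
  refine (measureReal_mono (fun ω hω => ?_)).trans
    (hcheb (P ν) (A ν) (π ν) hN0 (hA ν) (hπ ν) v hvar)
  simp only [Set.mem_ofPred_eq] at hω ⊢
  contrapose! hω
  have hg : ∀ j, |∑ i ∈ A ν ω, (π ν i)⁻¹ * z ν i j - ∑ i, z ν i j| ≤ K * √(N ν : ℝ) := by
    intro j
    have h := hω (Sum.inl j)
    simp only [hv, Sum.elim_inl] at h
    have h1 : ∀ i, π ν i * ((π ν i)⁻¹ * z ν i j) = z ν i j := fun i =>
      mul_inv_cancel_left₀ (hπ0 i).ne' _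
    simpa only [h1] using h
  have hH : ∀ j k, |∑ i ∈ A ν ω, z ν i j * z ν i k - ∑ i, π ν i * (z ν i j * z ν i k)| ≤
      K * √(N ν : ℝ) := by
    intro j k
    have h := hω (Sum.inr (Sum.inl (j, k)))
    simpa only [hv, Sum.elim_inl, Sum.elim_inr] using h
  have hE : ∀ j, |∑ i ∈ A ν ω, (π ν i)⁻¹ * ((π ν i)⁻¹ - 1) * (z ν i j * e ν i)| ≤
      K * √(N ν : ℝ) := by
    intro j
    have h := hω (Sum.inr (Sum.inr j))
    simp only [hv, Sum.elim_inr] at h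
    have h1 : ∀ i, π ν i * ((π ν i)⁻¹ * ((π ν i)⁻¹ - 1) * (z ν i j * e ν i)) =
        ((π ν i)⁻¹ - 1) * (z ν i j * e ν i) := fun i => by
      rw [mul_assoc, mul_inv_cancel_left₀ (hπ0 i).ne']
    simpa only [h1, he₀ j, sub_zero] using h
  obtain ⟨h, hh, hqr, hsol⟩ := hdual (z ν) (π ν) (hd ν) hS hq (A ν ω) hg hH
  have hqr' : ∀ i, q i * (R / √(N ν : ℝ)) ≤ a := hqr
  have hu : ∀ i, Real.log (1 - π ν i) ≤ -(2 * a) := fun i => by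
    have h2 : -(2 * a) = Real.log (1 - c₂⁻¹) := by rw [ha']; ring
    rw [h2]
    exact (log_one_sub_mem_Icc hc₁ (by linarith) (hd ν i)).2
  have hlam : ∀ i, z ν i ⬝ᵥ (l₀ + h) = Real.log (1 - π ν i) + z ν i ⬝ᵥ h := fun i => by
    rw [dotProduct_add, hl₀]
  refine ⟨l₀ + h, fun i _ => ?_, ?_, ?_⟩
  · rw [hlam]
    have h1 := (abs_dotProduct_le_sum_abs_mul_norm (z ν i) h).trans
      ((mul_le_mul_of_nonneg_left hh (hq0 i)).trans (hqr' i))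
    linarith [hu i, (abs_le.1 h1).2]
  · simpa only [hlam] using hsol
  · have hfin := abs_sum_crossEntropyInv_sub_mul_le (z ν) (fun i => Real.log (1 - π ν i)) (e ν)
      (A ν ω) h (G := K * √(N ν : ℝ)) (E := (2 * B + 1) * N ν) ha hh hu hqr'
      (by simpa only [crossEntropyInv_log (hπ1 _)] using hE)
      (by
        refine (Finset.sum_le_sum fun i _ => sq_mul_abs_le (q i) (e ν i)).trans ?_
        simp only [Finset.sum_add_distrib, Finset.sum_const, Finset.card_univ, Fintype.card_fin,
          nsmul_eq_mul]
        linarith)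
    simp only [crossEntropyInv_log (hπ1 _)] at hfin
    simp only [hlam]
    refine hfin.trans (le_of_eq ?_)
    rw [div_pow, hsq]
    field_simp

/-! ### Positive definiteness of Gram matrices -/

theorem exists_quadratic_lower_bound {ι : Type*} [Fintype ι] [Nonempty ι] {S : Matrix ι ι ℝ}
    (hS : S.PosDef) : ∃ c : ℝ, 0 < c ∧ ∀ h : ι → ℝ, c * ‖h‖ ^ 2 ≤ h ⬝ᵥ S.mulVec h := by
  have hcont : Continuous fun h : ι → ℝ => h ⬝ᵥ S.mulVec h := by
    unfold Matrix.mulVec dotProduct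
    fun_prop
  obtain ⟨h₀, hh₀, hmin⟩ := (isCompact_sphere (0 : ι → ℝ) 1).exists_isMinOn
    (NormedSpace.sphere_nonempty.2 zero_le_one) hcont.continuousOn
  have hne : h₀ ≠ 0 := by
    rintro rfl
    simp at hh₀
  refine ⟨h₀ ⬝ᵥ S.mulVec h₀, by simpa using hS.dotProduct_mulVec_pos hne, fun h => ?_⟩
  by_cases hz : h = 0
  · simp [hz]
  have hn : 0 < ‖h‖ := norm_pos_iff.2 hz
  have hmem : ‖h‖⁻¹ • h ∈ Metric.sphere (0 : ι → ℝ) 1 := by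
    simp [norm_smul, hn.ne']
  have h1 : _ ≤ (‖h‖⁻¹ • h) ⬝ᵥ S.mulVec (‖h‖⁻¹ • h) := hmin hmem
  simp only [Matrix.mulVec_smul, smul_dotProduct, dotProduct_smul, smul_eq_mul] at h1
  have h2 : ‖h‖⁻¹ * (‖h‖⁻¹ * h ⬝ᵥ S.mulVec h) * ‖h‖ ^ 2 = h ⬝ᵥ S.mulVec h := by
    field_simp
  rw [← h2]
  exact mul_le_mul_of_nonneg_right h1 (sq_nonneg _)

theorem eventually_quadratic_lower_bound {ι : Type*} [Fintype ι] [Nonempty ι]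
    (N : ℕ → ℕ) (hN : Tendsto N atTop atTop) (z : ∀ ν, Fin (N ν) → ι → ℝ)
    {S : Matrix ι ι ℝ} (hS : S.PosDef)
    (hlim : Tendsto (fun ν => (N ν : ℝ)⁻¹ • ∑ i, Matrix.vecMulVec (z ν i) (z ν i)) atTop (𝓝 S)) :
    ∃ c : ℝ, 0 < c ∧ ∀ᶠ ν in atTop, ∀ h : ι → ℝ,
      c * N ν * ‖h‖ ^ 2 ≤ ∑ i, (z ν i ⬝ᵥ h) ^ 2 := by
  obtain ⟨c, hc, hSc⟩ := exists_quadratic_lower_bound hS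
  set p : ℝ := (Fintype.card ι : ℝ) with hp
  have hp0 : 0 < p := by
    rw [hp]
    exact_mod_cast Fintype.card_pos
  -- An entrywise error `δ` perturbs the quadratic form by at most `p² δ ‖h‖²`, half of the limiting
  -- lower bound.
  set δ := c / (2 * p ^ 2) with hδ
  have hδ0 : 0 < δ := by positivity
  have hev : ∀ᶠ ν in atTop, ∀ j k,
      |(N ν : ℝ)⁻¹ * ∑ i, z ν i j * z ν i k - S j k| ≤ δ := by
    refine eventually_all.2 fun j => eventually_all.2 fun k => ?_
    have h1 : Tendsto (fun ν => (N ν : ℝ)⁻¹ * ∑ i, z ν i j * z ν i k) atTop (𝓝 (S j k)) := by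
      have := (hlim.apply_nhds j).apply_nhds k
      refine this.congr fun ν => ?_
      simp [Matrix.sum_apply, Matrix.vecMulVec_apply]
    filter_upwards [Metric.tendsto_nhds.1 h1 δ hδ0] with ν hν
    rw [Real.dist_eq] at hν
    exact hν.le
  refine ⟨c / 2, by positivity, ?_⟩
  filter_upwards [hev, hN.eventually_gt_atTop 0] with ν hν hN0 h
  have hN0' : (0 : ℝ) < N ν := by exact_mod_cast hN0
  have h1 := abs_sum_mul_mul_le h _ hν
  have h2 := sum_mul_dotProduct_sq Finset.univ (fun _ => (N ν : ℝ)⁻¹) (z ν) h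
  simp only [← Finset.mul_sum] at h2
  have h3 : ∑ j, ∑ k, h j * h k * S j k = h ⬝ᵥ S.mulVec h := by
    simp only [dotProduct, Matrix.mulVec, Finset.mul_sum]
    refine Finset.sum_congr rfl fun j _ => Finset.sum_congr rfl fun k _ => ?_
    ring
  simp only [mul_sub, Finset.sum_sub_distrib] at h1
  rw [h3, ← h2] at h1
  have h4 : p ^ 2 * δ = c / 2 := by
    rw [hδ]
    field_simp
  rw [← hp, h4] at h1
  have h5 := (abs_le.1 h1).1
  have h6 : c / 2 * ‖h‖ ^ 2 ≤ (N ν : ℝ)⁻¹ * ∑ i, (z ν i ⬝ᵥ h) ^ 2 := by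
    have := hSc h
    linarith
  have h7 := mul_le_mul_of_nonneg_left h6 hN0'.le
  rw [mul_inv_cancel_left₀ hN0'.ne'] at h7
  linarith

theorem posDef_of_quadratic {α ι : Type*} [Fintype α] [Fintype ι] (w : α → ℝ) (z : α → ι → ℝ)
    (hpos : ∀ h : ι → ℝ, h ≠ 0 → 0 < ∑ i, w i * (z i ⬝ᵥ h) ^ 2) :
    (Matrix.of fun j k => ∑ i, w i * (z i j * z i k)).PosDef := by
  refine Matrix.PosDef.of_dotProduct_mulVec_pos ?_ fun h hh => ?_
  · ext j k
    simp [mul_comm (z _ j)]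
  · have h1 := hpos h hh
    rw [sum_mul_dotProduct_sq Finset.univ w z h] at h1
    refine h1.trans_eq ?_
    simp only [star_trivial, dotProduct, Matrix.mulVec, Matrix.of_apply, Finset.mul_sum,
      Finset.sum_mul]
    refine Finset.sum_congr rfl fun j _ => Finset.sum_congr rfl fun k _ =>
      Finset.sum_congr rfl fun i _ => ?_
    ring

/-! ### Regression estimators under Poisson sampling -/

section Poisson

variable {Ω : Type*} [MeasurableSpace Ω] {P : Measure Ω} [IsProbabilityMeasure P] {N : ℕ}
  {A : Ω → Finset (Fin N)} {π : Fin N → ℝ} {ι : Type*} [Fintype ι]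

theorem covariance_htEstimator (hA : ∀ i, MeasurableSet {ω | i ∈ A ω})
    (hπ : ∀ i, π i = P.real {ω | i ∈ A ω}) (hπ0 : ∀ i, 0 < π i)
    (hind : iIndepFun (fun i ω => if i ∈ A ω then (1 : ℝ) else 0) P) (v w : Fin N → ℝ) :
    cov[fun ω => htEstimator π v (A ω), fun ω => htEstimator π w (A ω); P] =
      ∑ i, ((π i)⁻¹ - 1) * (v i * w i) := by
  refine (covariance_sum_sample_of_indep hA hπ hind (fun i => (π i)⁻¹ * v i)
    (fun i => (π i)⁻¹ * w i)).trans (Finset.sum_congr rfl fun i _ => ?_)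
  have := (hπ0 i).ne'
  field_simp

theorem variance_gregEstimator (hA : ∀ i, MeasurableSet {ω | i ∈ A ω})
    (hπ : ∀ i, π i = P.real {ω | i ∈ A ω}) (hπ0 : ∀ i, 0 < π i)
    (hind : iIndepFun (fun i ω => if i ∈ A ω then (1 : ℝ) else 0) P)
    (z : Fin N → ι → ℝ) (y : Fin N → ℝ) (ξ : ι → ℝ) :
    Var[fun ω => gregEstimator π z y ξ (A ω); P] =
      ∑ i, ((π i)⁻¹ - 1) * (y i - z i ⬝ᵥ ξ) ^ 2 := by
  unfold gregEstimator
  have hm := measurable_comp_sample hA fun s => ∑ i ∈ s, (π i)⁻¹ * (y i - z i ⬝ᵥ ξ)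
  rw [variance_const_add hm.aestronglyMeasurable, ← covariance_self hm.aemeasurable]
  simp only [sq]
  exact covariance_htEstimator hA hπ hπ0 hind _ _

theorem integral_gregEstimator (hA : ∀ i, MeasurableSet {ω | i ∈ A ω})
    (hπ : ∀ i, π i = P.real {ω | i ∈ A ω}) (hπ0 : ∀ i, 0 < π i)
    (z : Fin N → ι → ℝ) (y : Fin N → ℝ) (ξ : ι → ℝ) :
    ∫ ω, gregEstimator π z y ξ (A ω) ∂P = ∑ i, y i := by
  unfold gregEstimator
  rw [integral_add (integrable_const _) (integrable_comp_sample hA fun s =>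
    ∑ i ∈ s, (π i)⁻¹ * (y i - z i ⬝ᵥ ξ)), integral_sum_sample hA hπ, integral_const]
  simp only [mul_inv_cancel_left₀ (hπ0 _).ne', Finset.sum_sub_distrib, probReal_univ, one_smul]
  ring

theorem integral_sq_gregEstimator_sub (hA : ∀ i, MeasurableSet {ω | i ∈ A ω})
    (hπ : ∀ i, π i = P.real {ω | i ∈ A ω}) (hπ0 : ∀ i, 0 < π i)
    (z : Fin N → ι → ℝ) (y : Fin N → ℝ) (ξ : ι → ℝ) :
    ∫ ω, (gregEstimator π z y ξ (A ω) - ∑ i, y i) ^ 2 ∂P =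
      Var[fun ω => gregEstimator π z y ξ (A ω); P] := by
  rw [variance_eq_integral (measurable_comp_sample hA fun s =>
    gregEstimator π z y ξ s).aemeasurable, integral_gregEstimator hA hπ hπ0]

theorem posDef_htVarMatrix (hA : ∀ i, MeasurableSet {ω | i ∈ A ω})
    (hπ : ∀ i, π i = P.real {ω | i ∈ A ω}) (hπ0 : ∀ i, 0 < π i)
    (hind : iIndepFun (fun i ω => if i ∈ A ω then (1 : ℝ) else 0) P) (z : Fin N → ι → ℝ)
    (hpos : ∀ h : ι → ℝ, h ≠ 0 → 0 < ∑ i, ((π i)⁻¹ - 1) * (z i ⬝ᵥ h) ^ 2) :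
    (htVarMatrix P A π z).PosDef := by
  have h := posDef_of_quadratic _ z hpos
  convert h using 1
  ext j k
  exact covariance_htEstimator hA hπ hπ0 hind _ _

/-- Independence reduces the design covariances to sums weighted by `d_i - 1`, so `V γ = C` is the
system of weighted least squares normal equations. -/
theorem normal_equations_gammaOpt [DecidableEq ι] (hA : ∀ i, MeasurableSet {ω | i ∈ A ω})
    (hπ : ∀ i, π i = P.real {ω | i ∈ A ω}) (hπ0 : ∀ i, 0 < π i)
    (hind : iIndepFun (fun i ω => if i ∈ A ω then (1 : ℝ) else 0) P)
    (z : Fin N → ι → ℝ) (y : Fin N → ℝ) (hV : (htVarMatrix P A π z).PosDef) (j : ι) :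
    ∑ i, ((π i)⁻¹ - 1) * (z i j * (y i - z i ⬝ᵥ gammaOpt P A π z y)) = 0 := by
  have h : (htVarMatrix P A π z).mulVec (gammaOpt P A π z y) = htCovVec P A π z y := by
    unfold gammaOpt
    rw [Matrix.mulVec_mulVec, Matrix.mul_nonsing_inv _ hV.det_pos.ne'.isUnit, Matrix.one_mulVec]
  have hj := congrFun h j
  simp only [Matrix.mulVec, dotProduct, htVarMatrix, htCovVec, Matrix.of_apply,
    covariance_htEstimator hA hπ hπ0 hind, Finset.sum_mul] at hj
  rw [Finset.sum_comm] at hj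
  simp only [mul_sub, Finset.sum_sub_distrib]
  rw [sub_eq_zero, ← hj]
  simp only [dotProduct, Finset.mul_sum]
  refine Finset.sum_congr rfl fun i _ => Finset.sum_congr rfl fun k _ => ?_
  ring

end Poisson

/-! ### Weighted least squares -/

section LeastSquares

variable {α ι : Type*} [Fintype α] [Fintype ι] {w : α → ℝ} {z : α → ι → ℝ} {y : α → ℝ} {γ : ι → ℝ}

theorem sum_mul_dotProduct_residual
    (hγ : ∀ j, ∑ i, w i * (z i j * (y i - z i ⬝ᵥ γ)) = 0) (η : ι → ℝ) :
    ∑ i, w i * ((z i ⬝ᵥ η) * (y i - z i ⬝ᵥ γ)) = 0 := by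
  have h : ∑ i, w i * ((z i ⬝ᵥ η) * (y i - z i ⬝ᵥ γ)) =
      ∑ j, η j * ∑ i, w i * (z i j * (y i - z i ⬝ᵥ γ)) := by
    simp only [Finset.mul_sum]
    rw [Finset.sum_comm]
    refine Finset.sum_congr rfl fun i _ => ?_
    conv_lhs => rw [dotProduct, Finset.sum_mul, Finset.mul_sum]
    refine Finset.sum_congr rfl fun j _ => ?_
    ring
  rw [h]
  simp [hγ]

theorem sum_mul_residual_sq_le (hw : ∀ i, 0 ≤ w i)
    (hγ : ∀ j, ∑ i, w i * (z i j * (y i - z i ⬝ᵥ γ)) = 0) (ξ : ι → ℝ) :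
    ∑ i, w i * (y i - z i ⬝ᵥ γ) ^ 2 ≤ ∑ i, w i * (y i - z i ⬝ᵥ ξ) ^ 2 := by
  have h0 := sum_mul_dotProduct_residual hγ (ξ - γ)
  have h1 : ∑ i, w i * (y i - z i ⬝ᵥ ξ) ^ 2 = ∑ i, w i * (y i - z i ⬝ᵥ γ) ^ 2 -
      2 * ∑ i, w i * ((z i ⬝ᵥ (ξ - γ)) * (y i - z i ⬝ᵥ γ)) +
      ∑ i, w i * (z i ⬝ᵥ (ξ - γ)) ^ 2 := by
    rw [Finset.mul_sum, ← Finset.sum_sub_distrib, ← Finset.sum_add_distrib]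
    refine Finset.sum_congr rfl fun i _ => ?_
    rw [dotProduct_sub]
    ring
  have h2 : 0 ≤ ∑ i, w i * (z i ⬝ᵥ (ξ - γ)) ^ 2 :=
    Finset.sum_nonneg fun i _ => mul_nonneg (hw i) (sq_nonneg _)
  rw [h1, h0]
  linarith

/-- Testing the normal equations against `γ` itself gives `m c ‖γ‖² ≤ W E ‖γ‖`. This keeps `γ_opt`
bounded along the sequence, so that the residuals inherit fourth moments. -/
theorem norm_le_of_normal_equations [Nonempty α] {m W c E : ℝ} (hm : 0 < m) (hW : ∀ i, m ≤ w i ∧ w i ≤ W)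
    (hc : 0 < c) (hquad : ∀ h : ι → ℝ, c * ‖h‖ ^ 2 ≤ ∑ i, (z i ⬝ᵥ h) ^ 2)
    (hE : ∑ i, (∑ j, |z i j|) * |y i| ≤ E)
    (hγ : ∀ j, ∑ i, w i * (z i j * (y i - z i ⬝ᵥ γ)) = 0) :
    ‖γ‖ ≤ W * E / (m * c) := by
  have h0 := sum_mul_dotProduct_residual hγ γ
  have h1 : ∑ i, w i * ((z i ⬝ᵥ γ) * (y i - z i ⬝ᵥ γ)) =
      ∑ i, w i * ((z i ⬝ᵥ γ) * y i) - ∑ i, w i * (z i ⬝ᵥ γ) ^ 2 := by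
    rw [← Finset.sum_sub_distrib]
    exact Finset.sum_congr rfl fun i _ => by ring
  have h2 : m * ∑ i, (z i ⬝ᵥ γ) ^ 2 ≤ ∑ i, w i * (z i ⬝ᵥ γ) ^ 2 := by
    rw [Finset.mul_sum]
    exact Finset.sum_le_sum fun i _ => mul_le_mul_of_nonneg_right (hW i).1 (sq_nonneg _)
  have h3 : ∑ i, w i * ((z i ⬝ᵥ γ) * y i) ≤ W * ‖γ‖ * ∑ i, (∑ j, |z i j|) * |y i| := by
    rw [Finset.mul_sum]
    refine Finset.sum_le_sum fun i _ => ?_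
    have hw0 : 0 ≤ w i := hm.le.trans (hW i).1
    calc _ ≤ |w i * ((z i ⬝ᵥ γ) * y i)| := le_abs_self _
      _ = w i * (|z i ⬝ᵥ γ| * |y i|) := by rw [abs_mul, abs_mul, abs_of_nonneg hw0]
      _ ≤ W * (((∑ j, |z i j|) * ‖γ‖) * |y i|) := by
          refine mul_le_mul (hW i).2 ?_ (by positivity) (hw0.trans (hW i).2)
          exact mul_le_mul_of_nonneg_right (abs_dotProduct_le_sum_abs_mul_norm _ _) (abs_nonneg _)
      _ = _ := by ring
  obtain ⟨i⟩ := ‹Nonempty α›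
  have hW0 : 0 ≤ W := hm.le.trans ((hW i).1.trans (hW i).2)
  have h4 : W * ‖γ‖ * ∑ i, (∑ j, |z i j|) * |y i| ≤ W * ‖γ‖ * E :=
    mul_le_mul_of_nonneg_left hE (mul_nonneg hW0 (norm_nonneg _))
  have h5 := mul_le_mul_of_nonneg_left (hquad γ) hm.le
  rw [le_div_iff₀ (by positivity)]
  by_cases hz : γ = 0
  · have : 0 ≤ E := (Finset.sum_nonneg fun i _ => by positivity).trans hE
    rw [hz, norm_zero, zero_mul]
    positivity
  · have hn : 0 < ‖γ‖ := norm_pos_iff.2 hz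
    refine le_of_mul_le_mul_right ?_ hn
    nlinarith

end LeastSquares

/-! ### Moment bounds, the exact error identity and truncated risk -/

theorem tendsto_zero_of_forall_eventually_le {f : ℕ → ℝ} (h0 : ∀ ν, 0 ≤ f ν)
    (h : ∀ ε : ℝ, 0 < ε → ∀ᶠ ν in atTop, f ν ≤ ε) : Tendsto f atTop (𝓝 0) := by
  rw [Metric.tendsto_nhds]
  intro ε hε
  filter_upwards [h (ε / 2) (half_pos hε)] with ν hν
  rw [Real.dist_0_eq_abs, abs_of_nonneg (h0 ν)]
  linarith

theorem augCovariate_dotProduct_single {p N : ℕ} (x : Fin N → Fin p → ℝ) (π : Fin N → ℝ)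
    (i : Fin N) :
    augCovariate x π i ⬝ᵥ Sum.elim (fun _ => 0) (fun _ => 1) = Real.log (1 - π i) := by
  simp [augCovariate, dotProduct]

theorem sum_abs_augCovariate_pow_four_le {p N : ℕ} (x : Fin N → Fin p → ℝ) (π : Fin N → ℝ)
    (y : Fin N → ℝ) (i : Fin N) {b : ℝ} (hb : |Real.log (1 - π i)| ≤ b) :
    (∑ j, |augCovariate x π i j|) ^ 4 ≤
      8 * ((p : ℝ) ^ 2 * (y i ^ 2 + ∑ j, x i j ^ 2) ^ 2 + b ^ 4) := by
  have h1 : ∑ j, |augCovariate x π i j| = ∑ j, |x i j| + |Real.log (1 - π i)| := by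
    simp [augCovariate]
  have h2 : (∑ j, |x i j|) ^ 2 ≤ p * (y i ^ 2 + ∑ j, x i j ^ 2) := by
    have := sq_sum_le_card_mul_sum_sq (s := Finset.univ) (f := fun j => |x i j|)
    simp only [sq_abs, Finset.card_univ, Fintype.card_fin] at this
    refine this.trans ?_
    gcongr
    linarith [sq_nonneg (y i)]
  have h3 : (∑ j, |x i j|) ^ 4 ≤ (p : ℝ) ^ 2 * (y i ^ 2 + ∑ j, x i j ^ 2) ^ 2 := by
    calc _ = ((∑ j, |x i j|) ^ 2) ^ 2 := by ring
      _ ≤ (p * (y i ^ 2 + ∑ j, x i j ^ 2)) ^ 2 := pow_le_pow_left₀ (sq_nonneg _) h2 2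
      _ = _ := by ring
  have h4 : |Real.log (1 - π i)| ^ 4 ≤ b ^ 4 := pow_le_pow_left₀ (abs_nonneg _) hb 4
  rw [h1]
  have h5 := add_pow_le (Finset.sum_nonneg fun j _ => abs_nonneg (x i j) : 0 ≤ ∑ j, |x i j|)
    (abs_nonneg (Real.log (1 - π i))) 4
  norm_num at h5
  linarith

theorem sub_dotProduct_pow_four_le {ι : Type*} [Fintype ι] (z γ : ι → ℝ) (y : ℝ) {g : ℝ}
    (hγ : ‖γ‖ ≤ g) : (y - z ⬝ᵥ γ) ^ 4 ≤ 8 * (y ^ 4 + (∑ j, |z j|) ^ 4 * g ^ 4) := by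
  have h1 : |z ⬝ᵥ γ| ≤ (∑ j, |z j|) * g :=
    (abs_dotProduct_le_sum_abs_mul_norm z γ).trans
      (mul_le_mul_of_nonneg_left hγ (Finset.sum_nonneg fun j _ => abs_nonneg _))
  have h2 := pow_le_pow_left₀ (abs_nonneg _) h1 4
  have h3 := add_pow_le (abs_nonneg y) (abs_nonneg (z ⬝ᵥ γ)) 4
  have h4 := pow_le_pow_left₀ (abs_nonneg _) (abs_sub y (z ⬝ᵥ γ)) 4
  have heven : Even 4 := by decide
  rw [heven.pow_abs] at h4
  rw [heven.pow_abs] at h3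
  norm_num at h3
  rw [mul_pow] at h2
  linarith

/-- Calibration rewrites `∑_U z_i'γ` as the weighted sample total of `z_i'γ`, so the difference
involves only residuals, whatever `γ` is. -/
theorem weightedTotal_sub_gregEstimator {N : ℕ} {ι : Type*} [Fintype ι] (π y : Fin N → ℝ)
    (z : Fin N → ι → ℝ) (γ lam : ι → ℝ) (s : Finset (Fin N))
    (hfeas : ∑ i ∈ s, crossEntropyInv (z i ⬝ᵥ lam) • z i = ∑ i, z i) :
    weightedTotal y s (fun i : s => crossEntropyInv (z i ⬝ᵥ lam)) - gregEstimator π z y γ s =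
      ∑ i ∈ s, (crossEntropyInv (z i ⬝ᵥ lam) - (π i)⁻¹) * (y i - z i ⬝ᵥ γ) := by
  have h1 : weightedTotal y s (fun i : s => crossEntropyInv (z i ⬝ᵥ lam)) =
      ∑ i ∈ s, crossEntropyInv (z i ⬝ᵥ lam) * y i :=
    Finset.sum_coe_sort s fun i => crossEntropyInv (z i ⬝ᵥ lam) * y i
  have h2 : ∑ i, z i ⬝ᵥ γ = ∑ i ∈ s, crossEntropyInv (z i ⬝ᵥ lam) * (z i ⬝ᵥ γ) := by
    rw [← sum_dotProduct, ← hfeas, sum_dotProduct]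
    simp only [smul_dotProduct, smul_eq_mul]
  rw [h1, gregEstimator, h2, ← sub_sub, ← Finset.sum_sub_distrib, ← Finset.sum_sub_distrib]
  refine Finset.sum_congr rfl fun i _ => ?_
  ring

/-- Young's inequality on the cross term; the coefficient of `X²` can be taken arbitrarily close to
1. -/
theorem add_sq_le_of_abs_sub_le {X Y D η : ℝ} (hη : 0 < η) (h : |Y - X| ≤ D) :
    Y ^ 2 ≤ (1 + η) * X ^ 2 + (1 + η⁻¹) * D ^ 2 := by
  have h1 : (Y - X) ^ 2 ≤ D ^ 2 := by
    rw [← sq_abs]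
    exact pow_le_pow_left₀ (abs_nonneg _) h 2
  have hi : η * η⁻¹ = 1 := mul_inv_cancel₀ hη.ne'
  have hi0 : 0 < η⁻¹ := inv_pos.2 hη
  have h2 : 2 * X * (Y - X) ≤ η * X ^ 2 + η⁻¹ * (Y - X) ^ 2 := by
    have : 0 ≤ η⁻¹ * (η * X - (Y - X)) ^ 2 := by positivity
    have h3 : η⁻¹ * (η * X - (Y - X)) ^ 2 = (η * η⁻¹) * η * X ^ 2 -
      2 * (η * η⁻¹) * X * (Y - X) + η⁻¹ * (Y - X) ^ 2 := by ring
    rw [h3, hi] at this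
    linarith
  have h4 := mul_le_mul_of_nonneg_left h1 hi0.le
  have h5 : Y ^ 2 = X ^ 2 + 2 * X * (Y - X) + (Y - X) ^ 2 := by ring
  linarith

/-- Truncated risk of a variable which is close in probability to a square-integrable one. -/
theorem integral_min_sq_le {Ω : Type*} [MeasurableSpace Ω] {P : Measure Ω}
    [IsProbabilityMeasure P] {N : ℕ} {A : Ω → Finset (Fin N)}
    (hA : ∀ i, MeasurableSet {ω | i ∈ A ω}) (X Y : Finset (Fin N) → ℝ) {n M D η : ℝ}
    (hn : 0 ≤ n) (hη : 0 < η) :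
    ∫ ω, min (n * Y (A ω) ^ 2) M ∂P ≤
      (1 + η) * (n * ∫ ω, X (A ω) ^ 2 ∂P) + n * ((1 + η⁻¹) * D ^ 2) +
        M * P.real {ω | ¬ |Y (A ω) - X (A ω)| ≤ D} := by
  classical
  have hpt : ∀ ω, min (n * Y (A ω) ^ 2) M ≤
      (1 + η) * n * X (A ω) ^ 2 + n * ((1 + η⁻¹) * D ^ 2) +
        M * (if ¬ |Y (A ω) - X (A ω)| ≤ D then 1 else 0) := by
    intro ω
    by_cases h : |Y (A ω) - X (A ω)| ≤ D
    · have h1 := mul_le_mul_of_nonneg_left (add_sq_le_of_abs_sub_le hη h) hn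
      simp only [h, not_true_eq_false, if_false, mul_zero, add_zero]
      refine (min_le_left _ _).trans (h1.trans_eq ?_)
      ring
    · have h1 : 0 ≤ (1 + η) * n * X (A ω) ^ 2 + n * ((1 + η⁻¹) * D ^ 2) := by positivity
      simp only [h, not_false_eq_true, if_true, mul_one]
      exact (min_le_right _ _).trans (by linarith)
  have hi1 := integrable_comp_sample (P := P) hA fun s => (1 + η) * n * X s ^ 2
  have hi2 := integrable_comp_sample (P := P) hA
    fun s => M * (if ¬ |Y s - X s| ≤ D then 1 else 0)
  refine (integral_mono (integrable_comp_sample hA fun s => min (n * Y s ^ 2) M)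
    ((hi1.add (integrable_const _)).add hi2) hpt).trans_eq ?_
  rw [integral_add' (hi1.add (integrable_const _)) hi2, integral_add' hi1 (integrable_const _)]
  rw [integral_const_mul, integral_const_mul, integral_const, integral_const_mul,
    integral_inclusion_indicator (measurableSet_sample hA fun s => ¬ |Y s - X s| ≤ D)]
  simp only [probReal_univ, one_smul]
  ring

/-! ### Assembly of the asymptotic statements -/

theorem corollary1 {p : ℕ}
    -- an increasing sequence of finite populations `U = {1, …, N ν}`, with `y_i` and `x_i`
    (N : ℕ → ℕ) (hN : Tendsto N atTop atTop)
    (y : ∀ ν, Fin (N ν) → ℝ) (x : ∀ ν, Fin (N ν) → Fin p → ℝ)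
    -- the random samples `A` and their first-order inclusion probabilities
    {Ω : ℕ → Type*} [∀ ν, MeasurableSpace (Ω ν)]
    (P : ∀ ν, Measure (Ω ν)) [∀ ν, IsProbabilityMeasure (P ν)]
    (A : ∀ ν, Ω ν → Finset (Fin (N ν))) (hA : ∀ ν i, MeasurableSet {ω | i ∈ A ν ω})
    (π : ∀ ν, Fin (N ν) → ℝ) (hπ : ∀ ν i, π ν i = (P ν).real {ω | i ∈ A ν ω})
    -- the covariates `z_i = (x_i, log (1 - π_i))`
    (z : ∀ ν, Fin (N ν) → (Fin p ⊕ Unit) → ℝ) (hz : ∀ ν, z ν = augCovariate (x ν) (π ν))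
    -- the design weights stay in a compact part of the domain `(1, ∞)` of the cross entropy
    (c₁ c₂ : ℝ) (hc₁ : 1 < c₁) (hc₂ : 1 < c₂)
    (hd : ∀ ν i, c₁ < (π ν i)⁻¹ ∧ (π ν i)⁻¹ < c₂)
    -- `limsup N max_{i ≠ j} |π_ij - π_i π_j| < ∞`
    (hΔ : ∃ M : ℝ, ∀ᶠ ν in atTop, ∀ i j, i ≠ j →
      (N ν : ℝ) * |(P ν).real {ω | i ∈ A ν ω ∧ j ∈ A ν ω} - π ν i * π ν j| ≤ M)
    -- `∑_U z_i z_i' / N` has a positive definite limit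
    (hS : ∃ S : Matrix (Fin p ⊕ Unit) (Fin p ⊕ Unit) ℝ, S.PosDef ∧
      Tendsto (fun ν => (N ν : ℝ)⁻¹ • ∑ i, Matrix.vecMulVec (z ν i) (z ν i)) atTop (𝓝 S))
    -- `limsup ∑_U ‖(y_i, x_i)‖⁴ / N < ∞`, Euclidean norm
    (hmom : ∃ M : ℝ, ∀ᶠ ν in atTop,
      (N ν : ℝ)⁻¹ * ∑ i, (y ν i ^ 2 + ∑ j, x ν i j ^ 2) ^ 2 ≤ M)
    -- `lim ∑_U f'(λ' z_i) z_i z_i' / N` exists for `λ` near `λ₀ = (0, 1)`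
    (hΓ : ∀ᶠ lam in 𝓝 (Sum.elim (fun _ => 0) (fun _ => 1) : Fin p ⊕ Unit → ℝ),
      ∃ Γ : Matrix (Fin p ⊕ Unit) (Fin p ⊕ Unit) ℝ,
        Tendsto (fun ν => (N ν : ℝ)⁻¹ •
          ∑ i, deriv crossEntropyInv (lam ⬝ᵥ z ν i) • Matrix.vecMulVec (z ν i) (z ν i))
          atTop (𝓝 Γ)) :
    -- existence and uniqueness with probability tending to 1
    Tendsto (fun ν => (P ν).real
        {ω | ∃! w : A ν ω → ℝ, IsCrossEntropyWeight (z ν) (A ν ω) w}) atTop (𝓝 1) ∧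
    -- Poisson sampling
    ((∀ ν, iIndepFun (fun i ω => if i ∈ A ν ω then (1 : ℝ) else 0) (P ν)) →
      -- `γ_opt` is eventually well defined and minimizes the design variance in the class
      (∀ᶠ ν in atTop, (htVarMatrix (P ν) (A ν) (π ν) (z ν)).PosDef ∧
        ∀ ξ : Fin p ⊕ Unit → ℝ,
          Var[fun ω => gregEstimator (π ν) (z ν) (y ν)
            (gammaOpt (P ν) (A ν) (π ν) (z ν) (y ν)) (A ν ω); P ν] ≤
          Var[fun ω => gregEstimator (π ν) (z ν) (y ν) ξ (A ν ω); P ν]) ∧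
      -- `w` selects the solution wherever there is one
      ∀ w : ∀ ν, ∀ s : Finset (Fin (N ν)), s → ℝ,
        (∀ ν s, (∃ v, IsCrossEntropyWeight (z ν) s v) →
          IsCrossEntropyWeight (z ν) s (w ν s)) →
        -- `θ_cal - θ_opt = o_p(n^{-1/2} N)`
        (∀ ε : ℝ, 0 < ε → Tendsto (fun ν => (P ν).real
          {ω | ε * (N ν : ℝ) ≤ √((A ν ω).card : ℝ) *
            |weightedTotal (y ν) (A ν ω) (w ν (A ν ω)) -
              gregEstimator (π ν) (z ν) (y ν)
                (gammaOpt (P ν) (A ν) (π ν) (z ν) (y ν)) (A ν ω)|}) atTop (𝓝 0)) ∧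
        -- asymptotic optimality: the truncated scaled risk of `θ_cal` is asymptotically at most
        -- the scaled variance of every member of the class, uniformly over the class
        (∀ M : ℝ, 0 < M → ∀ ε : ℝ, 0 < ε → ∀ᶠ ν in atTop, ∀ ξ : Fin p ⊕ Unit → ℝ,
          ∫ ω, min ((N ν : ℝ)⁻¹ *
            (weightedTotal (y ν) (A ν ω) (w ν (A ν ω)) - ∑ i, y ν i) ^ 2) M ∂(P ν) ≤
          (N ν : ℝ)⁻¹ * Var[fun ω => gregEstimator (π ν) (z ν) (y ν) ξ (A ν ω); P ν] + ε)) := by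

  obtain ⟨S, hSpos, hSlim⟩ := hS
  obtain ⟨c, hc, hquad⟩ := eventually_quadratic_lower_bound N hN z hSpos hSlim
  obtain ⟨Mm, hMm⟩ := hmom
  set l₀ : Fin p ⊕ Unit → ℝ := Sum.elim (fun _ => 0) (fun _ => 1) with hl₀def
  have hl₀ : ∀ ν i, z ν i ⬝ᵥ l₀ = Real.log (1 - π ν i) := fun ν i => by
    rw [hz]
    exact augCovariate_dotProduct_single _ _ i
  have hπ0 : ∀ ν i, 0 < π ν i := fun ν i => inv_pos.1 (by linarith [(hd ν i).1])
  have hdw : ∀ ν i, c₁ - 1 ≤ (π ν i)⁻¹ - 1 ∧ (π ν i)⁻¹ - 1 ≤ c₂ := fun ν i =>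
    ⟨by linarith [(hd ν i).1], by linarith [(hd ν i).2]⟩
  have hNpos : ∀ᶠ ν in atTop, (0 : ℝ) < N ν := by
    filter_upwards [hN.eventually_gt_atTop 0] with ν hν
    exact_mod_cast hν
  set b := -Real.log (1 - c₁⁻¹) with hb
  have hlogb : ∀ ν i, |Real.log (1 - π ν i)| ≤ b := fun ν i => by
    have h1 := log_one_sub_mem_Icc hc₁ (by linarith) (hd ν i)
    have h2 := log_one_sub_inv_neg hc₂
    rw [abs_of_nonpos (h1.2.trans h2.le)]
    linarith [h1.1]
  have hmom' : ∀ᶠ ν in atTop, ∑ i, (y ν i ^ 2 + ∑ j, x ν i j ^ 2) ^ 2 ≤ Mm * N ν := by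
    filter_upwards [hMm, hNpos] with ν h1 h2
    rwa [inv_mul_le_iff₀ h2, mul_comm] at h1
  set B₁ := 8 * ((p : ℝ) ^ 2 * Mm + b ^ 4) with hB₁
  have hq : ∀ᶠ ν in atTop, ∑ i, (∑ j, |z ν i j|) ^ 4 ≤ B₁ * N ν := by
    filter_upwards [hmom'] with ν h1
    rw [hz]
    refine (Finset.sum_le_sum fun i _ =>
      sum_abs_augCovariate_pow_four_le (x ν) (π ν) (y ν) i (hlogb ν i)).trans ?_
    rw [← Finset.mul_sum, Finset.sum_add_distrib, ← Finset.mul_sum]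
    simp only [Finset.sum_const, Finset.card_univ, Fintype.card_fin, nsmul_eq_mul]
    have h2 := mul_le_mul_of_nonneg_left h1 (sq_nonneg (p : ℝ))
    rw [hB₁]
    linarith
  have hy4 : ∀ᶠ ν in atTop, ∑ i, y ν i ^ 4 ≤ Mm * N ν := by
    filter_upwards [hmom'] with ν h1
    refine (Finset.sum_le_sum fun i _ => ?_).trans h1
    have h2 : 0 ≤ ∑ j, x ν i j ^ 2 := Finset.sum_nonneg fun j _ => sq_nonneg _
    calc y ν i ^ 4 = (y ν i ^ 2) ^ 2 := by ring
      _ ≤ _ := pow_le_pow_left₀ (sq_nonneg _) (by linarith) 2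
  refine ⟨?_, fun hind => ?_⟩
  · have hB₁0 : ∀ᶠ ν in atTop, ∑ i : Fin (N ν), (0 : ℝ) ^ 4 ≤ B₁ * N ν := by
      filter_upwards [hq] with ν h1
      refine le_trans ?_ h1
      simp only [ne_eq, OfNat.ofNat_ne_zero, not_false_eq_true, zero_pow, Finset.sum_const_zero]
      positivity
    refine tendsto_order.2 ⟨fun t ht => ?_, fun t ht => ?_⟩
    -- With zero residuals the moment and orthogonality conditions on `e` are trivial, so no
    -- independence is needed.
    · obtain ⟨D, hD⟩ := calibration_bounded_in_probability N hN z (fun _ _ => 0) P A hA π hπ hc₁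
        hc₂ hd hΔ l₀ hl₀ hc hquad hq hB₁0 (by simp) (half_pos (sub_pos.2 ht))
      filter_upwards [hD] with ν hν
      have h1 := probReal_compl_eq_one_sub (μ := P ν) (measurableSet_sample (hA ν) fun s =>
        ¬ ∃ lam : Fin p ⊕ Unit → ℝ, (∀ i ∈ s, z ν i ⬝ᵥ lam < 0) ∧
          ∑ i ∈ s, crossEntropyInv (z ν i ⬝ᵥ lam) • z ν i = ∑ i, z ν i ∧
          |∑ i ∈ s, (crossEntropyInv (z ν i ⬝ᵥ lam) - (π ν i)⁻¹) * 0| ≤ D)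
      have h2 := measureReal_mono (μ := P ν) (s₁ := {ω | ¬ ∃ lam : Fin p ⊕ Unit → ℝ,
          (∀ i ∈ A ν ω, z ν i ⬝ᵥ lam < 0) ∧
          ∑ i ∈ A ν ω, crossEntropyInv (z ν i ⬝ᵥ lam) • z ν i = ∑ i, z ν i ∧
          |∑ i ∈ A ν ω, (crossEntropyInv (z ν i ⬝ᵥ lam) - (π ν i)⁻¹) * 0| ≤ D}ᶜ)
        (s₂ := {ω | ∃! w : A ν ω → ℝ, IsCrossEntropyWeight (z ν) (A ν ω) w}) (fun ω hω => by
          obtain ⟨lam, hneg, hfeas, -⟩ := not_not.1 hω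
          have hk := crossEntropyWeight_of_dual (z ν) (A ν ω) lam hneg hfeas
          exact ⟨_, (hk _).2 rfl, fun w hw => (hk w).1 hw⟩)
      rw [h1] at h2
      linarith
    · exact Eventually.of_forall fun ν => lt_of_le_of_lt measureReal_le_one ht
  have hV : ∀ᶠ ν in atTop, (htVarMatrix (P ν) (A ν) (π ν) (z ν)).PosDef := by
    filter_upwards [hquad, hNpos] with ν h1 h2
    refine posDef_htVarMatrix (hA ν) (hπ ν) (hπ0 ν) (hind ν) (z ν) fun h hh => ?_
    have hn : 0 < ‖h‖ := norm_pos_iff.2 hh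
    have h3 : 0 < (c₁ - 1) * (c * N ν * ‖h‖ ^ 2) := mul_pos (by linarith) (by positivity)
    refine h3.trans_le ((mul_le_mul_of_nonneg_left (h1 h) (by linarith)).trans ?_)
    rw [Finset.mul_sum]
    exact Finset.sum_le_sum fun i _ => mul_le_mul_of_nonneg_right (hdw ν i).1 (sq_nonneg _)
  set γ : ∀ _ : ℕ, Fin p ⊕ Unit → ℝ := fun ν => gammaOpt (P ν) (A ν) (π ν) (z ν) (y ν) with hγdef
  set e : ∀ ν, Fin (N ν) → ℝ := fun ν i => y ν i - z ν i ⬝ᵥ γ ν with hedef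
  have hnormal : ∀ᶠ ν in atTop, ∀ j, ∑ i, ((π ν i)⁻¹ - 1) * (z ν i j * e ν i) = 0 := by
    filter_upwards [hV] with ν h1 j
    exact normal_equations_gammaOpt (hA ν) (hπ ν) (hπ0 ν) (hind ν) (z ν) (y ν) h1 j
  have hopt : ∀ᶠ ν in atTop, ∀ ξ : Fin p ⊕ Unit → ℝ,
      Var[fun ω => gregEstimator (π ν) (z ν) (y ν) (γ ν) (A ν ω); P ν] ≤
        Var[fun ω => gregEstimator (π ν) (z ν) (y ν) ξ (A ν ω); P ν] := by
    filter_upwards [hnormal] with ν h1 ξ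
    rw [variance_gregEstimator (hA ν) (hπ ν) (hπ0 ν) (hind ν),
      variance_gregEstimator (hA ν) (hπ ν) (hπ0 ν) (hind ν)]
    exact sum_mul_residual_sq_le (fun i => by linarith [(hdw ν i).1]) h1 ξ
  -- The bound `W E / (m c)` with `W = c₂`, `m = c₁ - 1` and both `E` and the curvature proportional
  -- to `N`, which cancels.
  set g := c₂ * (2 + B₁ + Mm) / ((c₁ - 1) * c) with hg
  have hγ : ∀ᶠ ν in atTop, ‖γ ν‖ ≤ g := by
    filter_upwards [hnormal, hquad, hNpos, hq, hy4] with ν h1 h2 h3 h4 h5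
    have : Nonempty (Fin (N ν)) := Fin.pos_iff_nonempty.1 (by exact_mod_cast h3)
    have h6 : ∑ i, (∑ j, |z ν i j|) * |y ν i| ≤ (2 + B₁ + Mm) * N ν := by
      have h7 : ∀ i ∈ Finset.univ, (∑ j, |z ν i j|) * |y ν i| ≤
          2 + (∑ j, |z ν i j|) ^ 4 + y ν i ^ 4 := by
        intro i _
        have h8 := sq_abs (y ν i)
        nlinarith [sq_nonneg ((∑ j, |z ν i j|) - |y ν i|), sq_nonneg ((∑ j, |z ν i j|) ^ 2 - 1),
          sq_nonneg (y ν i ^ 2 - 1)]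
      refine (Finset.sum_le_sum h7).trans ?_
      rw [Finset.sum_add_distrib, Finset.sum_add_distrib]
      simp only [Finset.sum_const, Finset.card_univ, Fintype.card_fin, nsmul_eq_mul]
      linarith
    refine (norm_le_of_normal_equations (by linarith) (hdw ν) (by positivity) h2 h6 h1).trans
      (le_of_eq ?_)
    have h9 : c₁ - 1 ≠ 0 := by linarith
    rw [hg]
    field_simp
  set B := max B₁ (8 * (Mm + B₁ * g ^ 4)) with hB
  have hqB : ∀ᶠ ν in atTop, ∑ i, (∑ j, |z ν i j|) ^ 4 ≤ B * N ν := by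
    filter_upwards [hq] with ν h1
    exact h1.trans (mul_le_mul_of_nonneg_right (le_max_left _ _) (Nat.cast_nonneg _))
  have heB : ∀ᶠ ν in atTop, ∑ i, e ν i ^ 4 ≤ B * N ν := by
    filter_upwards [hq, hy4, hγ] with ν h1 h2 h3
    refine le_trans ?_ (mul_le_mul_of_nonneg_right (le_max_right _ _) (Nat.cast_nonneg _))
    refine (Finset.sum_le_sum fun i _ =>
      sub_dotProduct_pow_four_le (z ν i) (γ ν) (y ν i) h3).trans ?_
    rw [← Finset.mul_sum, Finset.sum_add_distrib, ← Finset.sum_mul]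
    have h4 := mul_le_mul_of_nonneg_right h1 (show 0 ≤ g ^ 4 by positivity)
    linarith
  refine ⟨hV.and hopt, fun w hw => ?_⟩
  have hcal : ∀ ε : ℝ, 0 < ε → ∃ D : ℝ, ∀ᶠ ν in atTop, (P ν).real
      {ω | ¬ |weightedTotal (y ν) (A ν ω) (w ν (A ν ω)) -
        gregEstimator (π ν) (z ν) (y ν) (γ ν) (A ν ω)| ≤ D} ≤ ε := by
    intro ε hε
    obtain ⟨D, hD⟩ := calibration_bounded_in_probability N hN z e P A hA π hπ hc₁
      hc₂ hd hΔ l₀ hl₀ hc hquad hqB heB hnormal hε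
    refine ⟨D, ?_⟩
    filter_upwards [hD] with ν hν
    refine (measureReal_mono fun ω hω => ?_).trans hν
    refine fun hgood => hω ?_
    obtain ⟨lam, hneg, hfeas, hle⟩ := hgood
    have hk := crossEntropyWeight_of_dual (z ν) (A ν ω) lam hneg hfeas
    -- Where the dual equation is solved the minimizer is unique, so the selected weights must be
    -- the dual ones.
    rw [(hk _).1 (hw ν (A ν ω) ⟨_, (hk _).2 rfl⟩),
      weightedTotal_sub_gregEstimator (π ν) (y ν) (z ν) (γ ν) lam (A ν ω) hfeas]
    exact hle
  have hNR : Tendsto (fun ν => (N ν : ℝ)) atTop atTop := tendsto_natCast_atTop_atTop.comp hN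
  refine ⟨fun ε hε => ?_, fun M hM ε hε => ?_⟩
  · refine tendsto_zero_of_forall_eventually_le (fun ν => measureReal_nonneg) fun ε' hε' => ?_
    obtain ⟨D, hD⟩ := hcal ε' hε'
    filter_upwards [hD, hNpos,
      (Real.tendsto_sqrt_atTop.comp hNR).eventually_gt_atTop (|D| / ε)] with ν h1 h2 h3
    refine (measureReal_mono fun ω hω => ?_).trans h1
    intro hle
    -- Since `n ≤ N`, an error bounded by `D` gives at most `√N |D|`, eventually below `ε N`.
    have h4 : √((A ν ω).card : ℝ) ≤ √(N ν : ℝ) := by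
      refine Real.sqrt_le_sqrt ?_
      have := Finset.card_le_univ (A ν ω)
      rw [Fintype.card_fin] at this
      exact_mod_cast this
    have h5 : 0 < √(N ν : ℝ) := Real.sqrt_pos.2 h2
    have h6 := mul_le_mul h4 (hle.trans (le_abs_self D)) (abs_nonneg _) h5.le
    have h7 : |D| < √(N ν : ℝ) * ε := (div_lt_iff₀ hε).1 h3
    have h8 := mul_lt_mul_of_pos_left h7 h5
    rw [← mul_assoc, Real.mul_self_sqrt h2.le] at h8
    have h9 : ε * (N ν : ℝ) ≤ _ := hω
    linarith
  -- The error `ε` is split in three: the exceptional event costs `M · ε / (3 M)`, the inflation `η`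
  -- of a scaled variance bounded by `v` costs `η v = ε / 3`, and the term in `D²` is divided by
  -- `N`. Only the optimal variance enters, so the threshold is uniform in `ξ`.
  · obtain ⟨D, hD⟩ := hcal (ε / (3 * M)) (by positivity)
    set v := c₂ * (1 + |B|) with hv
    have hv0 : 0 < v := by positivity
    set η := ε / (3 * v) with hη
    have hη0 : 0 < η := by positivity
    filter_upwards [hD, hNpos, hopt, heB,
      hNR.eventually_ge_atTop ((1 + η⁻¹) * D ^ 2 / (ε / 3))] with ν h1 h2 h3 h4 h5 ξ
    have hvar : (N ν : ℝ)⁻¹ *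
        Var[fun ω => gregEstimator (π ν) (z ν) (y ν) (γ ν) (A ν ω); P ν] ≤ v := by
      rw [inv_mul_le_iff₀ h2, variance_gregEstimator (hA ν) (hπ ν) (hπ0 ν) (hind ν)]
      have h6 : ∀ i ∈ Finset.univ, ((π ν i)⁻¹ - 1) * e ν i ^ 2 ≤ c₂ * (1 + e ν i ^ 4) := by
        intro i _
        refine mul_le_mul (hdw ν i).2 ?_ (sq_nonneg _) (by linarith)
        nlinarith [sq_nonneg (e ν i ^ 2 - 1)]
      refine (Finset.sum_le_sum h6).trans ?_
      rw [← Finset.mul_sum, Finset.sum_add_distrib]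
      simp only [Finset.sum_const, Finset.card_univ, Fintype.card_fin, nsmul_eq_mul, mul_one]
      have h7 := h4.trans (mul_le_mul_of_nonneg_right (le_abs_self B) h2.le)
      have h8 : (N ν : ℝ) * v = c₂ * (N ν + |B| * N ν) := by rw [hv]; ring
      rw [h8]
      exact mul_le_mul_of_nonneg_left (by linarith) (by linarith)
    have hrisk := integral_min_sq_le (P := P ν) (hA ν)
      (fun s => gregEstimator (π ν) (z ν) (y ν) (γ ν) s - ∑ i, y ν i)
      (fun s => weightedTotal (y ν) s (w ν s) - ∑ i, y ν i) (n := (N ν : ℝ)⁻¹) (M := M) (D := D)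
      (inv_pos.2 h2).le hη0
    simp only [sub_sub_sub_cancel_right] at hrisk
    rw [integral_sq_gregEstimator_sub (hA ν) (hπ ν) (hπ0 ν)] at hrisk
    have h9 := mul_le_mul_of_nonneg_left (h3 ξ) (inv_pos.2 h2).le
    have h10 := mul_le_mul_of_nonneg_left hvar hη0.le
    have h11 : η * v = ε / 3 := by
      rw [hη]
      field_simp
    have h12 := mul_le_mul_of_nonneg_left h1 hM.le
    have h13 : M * (ε / (3 * M)) = ε / 3 := by field_simp
    have h14 : (N ν : ℝ)⁻¹ * ((1 + η⁻¹) * D ^ 2) ≤ ε / 3 := by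
      rw [inv_mul_le_iff₀ h2]
      exact (div_le_iff₀ (by positivity)).1 h5
    linarith
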